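/- Let $Q$ be a star: $n\ge 2$ arcs of positive lengths $\ell_1,\dots,\ell_n$, arc $i$ joining a common center to its leaf node $x_i$, with the shortest-path metric $d$, the length measure $\lambda$ (Lebesgue measure on each arc) and total length $\mu=\lambda(Q)=\sum_i\ell_i$. (For $n=2$ this is a line segment with an artificial node placed on it.) Interior points of arcs are called regular. Let $0<\alpha<2\mu$. Game. The Attacker chooses a point $x\in Q$ and a start time $\tau\ge 0$; the Patroller chooses a $1$-Lipschitz path $S:[0,\infty)\to Q$ (a patrol) and intercepts the attack if $S(t)=x$ for some $t\in[\tau,\tau+\alpha]$. The payoff to the Patroller (the maximizer) is the probability of interception; both players may use mixed strategies (probability measures on their pure strategies). The value $V$, when it exists, is the common value of $\sup\inf$ and $\inf\sup$ of the payoff. Extremity set. $E=E(Q,\alpha)$ is the set of all regular points $x$ such that one of the two connected components of $Q\setminus\{x\}$ has length less than $\alpha/2$. Leaf Condition. $E$ consists of all regular points that are at distance less than $\alpha/2$ from the leaf node of their arc. $E$-attack strategy. Let $E_i$ be the component of $E$ whose closure contains $x_i$, $e_i=\lambda(E_i)$ and $M=\max_i e_i$. With probability $\lambda(E^c)/(\mu+\lambda(E))$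 attack a uniformly random point of $E^c$ at time $M$; with probability $2e_i/(\mu+\lambda(E))$ attack $x_i$ at a start time that is uniform in $[M-e_i,M+e_i]$. $E$-patrolling strategies. A Chinese Postman Tour (CPT) is a closed unit speed path of minimum length visiting all points of $Q$. If $\bar E=Q$, let $S^E$ be any CPT. Otherwise take a CPT $S$ that starts at a regular point outside $\bar E$ and in which every connected component $K$ of $\bar E$ is searched in a single CPT $C_K$ of $K$, that is, during one time interval of length $2\lambda(K)$ at whose two ends $S$ is at the same point. For every $K$ insert a second copy of $C_K$ into $S$: immediately after the first one if $\lambda(K)\ge\alpha/2$, and at the next return of $S$ to $K$ after the first one if $\lambda(K)<\alpha/2$. The result is a closed path $S^E$. If $L$ is its length, the $E$-patrolling strategy is to follow the patrol $t\mapsto S^E((t+\Delta)\bmod L)$ with $\Delta$ uniform in $[0,L]$. Claim. Suppose that either (i) $Q$ is balanced, i.e. $\ell_i\le\mu/2$ for all $i$, or (ii) $\alpha\ge 2\max_i\ell_i$. Then the Leaf Condition holds, the $E$-attack strategy is optimal for the Attacker, $E$-patrolling strategies exist and every one of them is optimal for the Patroller, and the game has the value $$V=\frac{\alpha}{\mu+\lambda(E)}.$$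 -/

import Mathlib

open MeasureTheory Set
open scoped NNReal ENNReal

noncomputable section

/-- The data of a star network with `n` arcs: the lengths of its arcs. Every arc joins the common
center to its own leaf node. -/
structure StarNetwork (n : ℕ) where
  /-- the length of each arc -/
  len : Fin n → ℝ
  len_pos : ∀ i, 0 < len i

namespace StarNetwork

variable {n : ℕ} (Q : StarNetwork n)

/-- The star, realized as a union of segments on the positive coordinate half-axes of `ℝⁿ` with the
`ℓ¹` metric: arc `i` is `{t eᵢ : 0 ≤ t ≤ len i}`. The `ℓ¹` distance restricted to this set is
the length of a shortest path inside it: `|s - t|` for two points at distances `s`, `t` from the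
center on the same arc, and `s + t` for points on different arcs. -/
def carrier : Set (PiLp 1 (fun _ : Fin n => ℝ)) :=
  {x | ∃ i, ∃ t : ℝ, 0 ≤ t ∧ t ≤ Q.len i ∧ x = PiLp.single 1 i t}

/-- The points of the star, a metric space with its Borel sets. -/
abbrev Point : Type := Q.carrier

/-- The point of arc `i` at distance `t` from the center (`t` is clamped to `[0, len i]`). -/
def arc (i : Fin n) (t : ℝ) : Q.Point :=
  ⟨PiLp.single 1 i (max 0 (min t (Q.len i))), i, max 0 (min t (Q.len i)), le_max_left _ _,
    max_le (Q.len_pos i).le (min_le_right _ _), rfl⟩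

/-- The leaf node of arc `i`. -/
def leaf (i : Fin n) : Q.Point := Q.arc i (Q.len i)

/-- The regular points, that is, the interior points of arcs. -/
def IsRegular (x : Q.Point) : Prop := ∃ i, ∃ t : ℝ, 0 < t ∧ t < Q.len i ∧ x = Q.arc i t

/-- The measure `λ` (length): Lebesgue measure on every arc. -/
def length : Measure Q.Point :=
  ∑ i, (volume.restrict (Icc 0 (Q.len i))).map (Q.arc i)

/-- The total length `μ`. -/
def totalLength : ℝ := ∑ i, Q.len i

/-- A star is balanced if no arc comprises more than half of its total length. -/
def IsBalanced : Prop := ∀ i, Q.len i ≤ Q.totalLength / 2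

/-! ### The patrolling game -/

/-- A patrol: a unit speed (that is, 1-Lipschitz) path `S(t)`, `t ≥ 0`. As a subtype of a function
space it carries the σ-algebra generated by the positions at all times. -/
abbrev Patrol : Type := {S : ℝ≥0 → Q.Point // LipschitzWith 1 S}

/-- An attack: the attacked point and the starting time. -/
abbrev Attack : Type := Q.Point × ℝ≥0

/-- The patrol visits the attacked point during the attack interval `[τ, τ + α]`. -/
def Intercepts (α : ℝ) (S : Q.Patrol) (a : Q.Attack) : Prop :=
  ∃ t : ℝ≥0, a.2 ≤ t ∧ (t : ℝ) ≤ a.2 + α ∧ S.1 t = a.1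

/-- The probability of interception when the patrol is drawn from `σ` and, independently, the
attack is drawn from `m`. -/
def payoff (α : ℝ) (σ : Measure Q.Patrol) (m : Measure Q.Attack) : ℝ≥0∞ :=
  (σ.prod m) {p | Q.Intercepts α p.1 p.2}

/-- The interception probability that the Patroller can guarantee (as a supremum). -/
def lowerValue (α : ℝ) : ℝ≥0∞ :=
  ⨆ σ : ProbabilityMeasure Q.Patrol, ⨅ m : ProbabilityMeasure Q.Attack,
    Q.payoff α (σ : Measure Q.Patrol) (m : Measure Q.Attack)

/-- The bound on the interception probability that the Attacker can guarantee (as an infimum). -/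
def upperValue (α : ℝ) : ℝ≥0∞ :=
  ⨅ m : ProbabilityMeasure Q.Attack, ⨆ σ : ProbabilityMeasure Q.Patrol,
    Q.payoff α (σ : Measure Q.Patrol) (m : Measure Q.Attack)

/-- The game with attack duration `α` has a value, and it is `V`. -/
def HasValue (α V : ℝ) : Prop :=
  Q.lowerValue α = ENNReal.ofReal V ∧ Q.upperValue α = ENNReal.ofReal V

/-- `σ` is an optimal mixed strategy of the Patroller. -/
def IsOptimalPatrol (α : ℝ) (σ : Measure Q.Patrol) : Prop :=
  IsProbabilityMeasure σ ∧
    ⨅ m : ProbabilityMeasure Q.Attack, Q.payoff α σ (m : Measure Q.Attack) = Q.lowerValue α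

/-- `m` is an optimal mixed strategy of the Attacker. -/
def IsOptimalAttack (α : ℝ) (m : Measure Q.Attack) : Prop :=
  IsProbabilityMeasure m ∧
    ⨆ σ : ProbabilityMeasure Q.Patrol, Q.payoff α (σ : Measure Q.Patrol) m = Q.upperValue α

/-! ### The extremity set and the attack strategy built on it -/

/-- The extremity set `E`: the regular points `x` such that one of the connected components of the
complement of `x` has length less than `α / 2`. -/
def extremitySet (α : ℝ) : Set Q.Point :=
  {x | Q.IsRegular x ∧
    ∃ y, y ≠ x ∧ Q.length (connectedComponentIn {x}ᶜ y) < ENNReal.ofReal (α / 2)}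

/-- The leaf condition: `E` consists of the (regular) points on the leaf arcs whose distance from
the leaf node of their arc is less than `α / 2`. -/
def LeafCondition (α : ℝ) : Prop :=
  Q.extremitySet α =
    {x | ∃ i, ∃ t : ℝ, 0 < t ∧ t < Q.len i ∧ x = Q.arc i t ∧ dist x (Q.leaf i) < α / 2}

/-- The component of `E` whose closure contains the leaf node of arc `i`. -/
def leafComponent (α : ℝ) (i : Fin n) : Set Q.Point :=
  {y | y ∈ Q.extremitySet α ∧
    Q.leaf i ∈ closure (connectedComponentIn (Q.extremitySet α) y)}

/-- The length `eᵢ` of the component of `E` at the leaf node of arc `i`. -/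
def leafComponentLength (α : ℝ) (i : Fin n) : ℝ := Q.length.real (Q.leafComponent α i)

/-- The maximal length `M` of a component of `E` at a leaf node. -/
def maxComponentLength (α : ℝ) : ℝ := ⨆ i, Q.leafComponentLength α i

/-- The `E`-attack strategy: with probability `λ(Eᶜ) / (μ + λ(E))`, attack a uniformly random point
of `Eᶜ` at time `M`; with probability `2 eᵢ / (μ + λ(E))`, attack the leaf node of arc `i` at a
start time that is uniform in `[M - eᵢ, M + eᵢ]`. -/
def eAttack (α : ℝ) : Measure Q.Attack :=
  ENNReal.ofReal (Q.length.real (Q.extremitySet α)ᶜ /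
      (Q.totalLength + Q.length.real (Q.extremitySet α))) •
    (ProbabilityTheory.cond Q.length (Q.extremitySet α)ᶜ).map
      (fun x => ((x, (Q.maxComponentLength α).toNNReal) : Q.Attack)) +
  ∑ i, ENNReal.ofReal (2 * Q.leafComponentLength α i /
      (Q.totalLength + Q.length.real (Q.extremitySet α))) •
    (ProbabilityTheory.cond (volume : Measure ℝ)
      (Icc (Q.maxComponentLength α - Q.leafComponentLength α i)
        (Q.maxComponentLength α + Q.leafComponentLength α i))).map
      (fun t => ((Q.leaf i, t.toNNReal) : Q.Attack))

/-! ### Closed paths and the patrolling strategies built on the extremity set -/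

/-- A closed unit speed path `[0, L] → Q`, identified with its `L`-periodic extension to `ℝ`. -/
structure ClosedPath where
  /-- the path, extended periodically -/
  toFun : ℝ → Q.Point
  /-- the time `L` that the path takes -/
  period : ℝ
  period_pos : 0 < period
  lipschitz : LipschitzWith 1 toFun
  periodic : Function.Periodic toFun period

/-- A closed path is a tour if it visits all points. -/
def ClosedPath.IsTour {Q : StarNetwork n} (S : Q.ClosedPath) : Prop :=
  ∀ x, ∃ t ∈ Icc 0 S.period, S.toFun t = x

/-- A Chinese Postman Tour: a tour of minimum length. -/
def ClosedPath.IsCPT {Q : StarNetwork n} (S : Q.ClosedPath) : Prop :=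
  S.IsTour ∧ ∀ S' : Q.ClosedPath, S'.IsTour → S.period ≤ S'.period

/-- The patrol `t ↦ S ((t + Δ) mod L)`. -/
def ClosedPath.shift {Q : StarNetwork n} (S : Q.ClosedPath) (Δ : ℝ) : Q.Patrol :=
  ⟨fun t => S.toFun (t + Δ), LipschitzWith.of_dist_le_mul fun t t' => by
    have h := S.lipschitz.dist_le_mul ((t : ℝ) + Δ) (t' + Δ)
    rwa [dist_add_right] at h⟩

/-- The randomized periodic extension: the patrol `S.shift Δ`, with `Δ` uniform in `[0, L]`. -/
def ClosedPath.randomized {Q : StarNetwork n} (S : Q.ClosedPath) : Measure Q.Patrol :=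
  (ProbabilityTheory.cond (volume : Measure ℝ) (Icc 0 S.period)).map S.shift

/-- The connected components of the closure of `E`. -/
def closureComponents (α : ℝ) : Set (Set Q.Point) :=
  {K | ∃ x ∈ closure (Q.extremitySet α),
    K = connectedComponentIn (closure (Q.extremitySet α)) x}

/-- In the closed path `S`, the component `K` is searched in a single CPT of `K`, namely during
`[s, s + 2 λ(K)]`, and `r` is the time at which a second copy of this local tour is to be inserted:
immediately after the first copy if `λ(K) ≥ α / 2`, and when `S` next returns to `K` after the
first copy if `λ(K) < α / 2`. -/
def IsLocalSearch (α : ℝ) (S : Q.ClosedPath) (K : Set Q.Point) (s r : ℝ) : Prop :=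
  0 ≤ s ∧ s + 2 * Q.length.real K ≤ S.period ∧
  S.toFun s = S.toFun (s + 2 * Q.length.real K) ∧
  S.toFun '' Icc s (s + 2 * Q.length.real K) = K ∧
  (α / 2 ≤ Q.length.real K → r = s + 2 * Q.length.real K) ∧
  (Q.length.real K < α / 2 →
    s + 2 * Q.length.real K < r ∧ r ≤ S.period ∧ S.toFun r ∈ K ∧
    ∀ t ∈ Ioo (s + 2 * Q.length.real K) r, S.toFun t ∉ K)

/-- The amount by which time `t` of the original path is postponed when, for every component `K`
of the closure of `E`, a local tour of duration `2 λ(K)` is inserted at time `r K`: the total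
duration of the tours inserted before time `t`. -/
def delay (α : ℝ) (r : Set Q.Point → ℝ) (t : ℝ) : ℝ :=
  ∑ᶠ K ∈ {K | K ∈ Q.closureComponents α ∧ r K < t}, 2 * Q.length.real K

/-- `P` is the tour of an `E`-patrolling strategy. If the closure of `E` is the whole star, this is
any CPT. Otherwise it arises from a CPT `S` that starts at a regular point outside the closure of
`E` and searches every component `K` of this closure in a single CPT of `K`, by the insertion of a
second copy of each of these local tours. The last two clauses give `P` at the
(postponed) times of the original path and during the inserted local tours. -/
def IsEPatrolTour (α : ℝ) (P : Q.ClosedPath) : Prop :=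
  (closure (Q.extremitySet α) = univ ∧ P.IsCPT) ∨
  (closure (Q.extremitySet α) ≠ univ ∧
    ∃ S : Q.ClosedPath, S.IsCPT ∧ Q.IsRegular (S.toFun 0) ∧
      S.toFun 0 ∉ closure (Q.extremitySet α) ∧
      ∃ s r : Set Q.Point → ℝ,
        (∀ K ∈ Q.closureComponents α, Q.IsLocalSearch α S K (s K) (r K)) ∧
        P.period = S.period + ∑ᶠ K ∈ Q.closureComponents α, 2 * Q.length.real K ∧
        (∀ t ∈ Icc 0 S.period, P.toFun (t + Q.delay α r t) = S.toFun t) ∧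
        (∀ K ∈ Q.closureComponents α, ∀ v ∈ Icc 0 (2 * Q.length.real K),
          P.toFun (r K + Q.delay α r (r K) + v) = S.toFun (s K + v)))

end StarNetwork

end

noncomputable section

namespace StarNetwork

/-! ### Geometry of the star: distances, lengths, packing of leaf visits in time -/

section Geometry

variable {n : ℕ} (Q : StarNetwork n)

/-! ### Points of the star -/

/-! Write c_i = min(α/2, ℓ_i) (`extremityLength`). Under either hypothesis E consists, on each arc,
of the regular points within c_i of the leaf, so λ(E) = ∑ c_i. The value V = α/(μ + λ(E)) is reached
from both sides by explicit strategies.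

Attacker. Multiplied by μ + λ(E), the E-attack is length measure on Eᶜ plus, at each leaf, Lebesgue
measure on a window of start times of length 2c_i. A fixed patrol has α units of time in [M, M + α].
The times spent within c_i of leaf i pay for the intercepted attacks at that leaf
(`volume_intercepted_le`). The remaining times pay for the points of Eᶜ that are reached, because a
1-Lipschitz path covers no more length than the time it uses (`length_le_volume_of_lipschitz`).
These sets of times are disjoint, so at most α is intercepted (`LeafCondition.intercepted_le`).

Patroller. If a closed path of length L passes through x at two times that are at least α apart on
the circle of length L, its uniform shift intercepts an attack at x with probability at least 2α/L.
Here L = 2(μ + λ(E)), so it suffices that every point is visited twice in this sense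
(`IsEPatrolTour.visitsTwice`). For points outside the closure of E, the two visits surround a visit
to the leaf of their arc, and balance keeps the rest of the tour long enough. For points of a
component K they come from the two copies of the local tour; if λ(K) < α/2 then K is the union of
the short arcs, and a Chinese Postman Tour that leaves it returns after exactly one long arc
(`ClosedPath.IsTour.excursion_eq`). If the closure of E is all of Q, then λ(E) = μ and one visit per
period 2μ is enough. Otherwise some arc is longer than α/2, which leaves only the balanced case.

Lower bounds on durations come from one packing principle: visits to leaves i and j are at least ℓ_i
+ ℓ_j apart in time (`sum_two_mul_le_of_separated`). For existence, arcs are toured in increasing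
order of length, starting inside the longest one, and the local tours are inserted by
`ClosedPath.exists_insertion`. -/

lemma arc_val {i : Fin n} {t : ℝ} (h0 : 0 ≤ t) (h1 : t ≤ Q.len i) :
    (Q.arc i t).1 = PiLp.single 1 i t := by
  simp only [arc]
  rw [min_eq_left h1, max_eq_right h0]

lemma exists_eq_arc (x : Q.Point) : ∃ i t, 0 ≤ t ∧ t ≤ Q.len i ∧ x = Q.arc i t := by
  obtain ⟨i, t, h0, h1, h⟩ := x.2
  exact ⟨i, t, h0, h1, Subtype.ext (by rw [h, arc_val Q h0 h1])⟩

lemma arc_zero (i j : Fin n) : Q.arc i 0 = Q.arc j 0 := by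
  apply Subtype.ext
  rw [arc_val Q le_rfl (Q.len_pos i).le, arc_val Q le_rfl (Q.len_pos j).le]
  ext k
  simp [PiLp.single_apply]

lemma dist_arc_same {i : Fin n} {s t : ℝ} (hs : 0 ≤ s) (hs' : s ≤ Q.len i) (ht : 0 ≤ t)
    (ht' : t ≤ Q.len i) : dist (Q.arc i s) (Q.arc i t) = |s - t| := by
  rw [Subtype.dist_eq, arc_val Q hs hs', arc_val Q ht ht',
    PiLp.dist_single_same 1 (fun _ : Fin n => ℝ), Real.dist_eq]

lemma dist_arc_ne {i j : Fin n} (hij : i ≠ j) {s t : ℝ} (hs : 0 ≤ s) (hs' : s ≤ Q.len i)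
    (ht : 0 ≤ t) (ht' : t ≤ Q.len j) : dist (Q.arc i s) (Q.arc j t) = s + t := by
  rw [Subtype.dist_eq, arc_val Q hs hs', arc_val Q ht ht', PiLp.dist_eq_of_L1,
    Finset.sum_eq_add i j hij]
  · simp [hij, hij.symm, abs_of_nonneg hs, abs_of_nonneg ht, Real.dist_eq]
  · intro k _ hk
    simp [hk.1, hk.2]
  · simp
  · simp

lemma lipschitzWith_arc (i : Fin n) : LipschitzWith 1 (Q.arc i) := by
  refine LipschitzWith.of_dist_le_mul fun s t => ?_
  rw [Subtype.dist_eq]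
  simp only [arc]
  rw [PiLp.dist_single_same 1 (fun _ : Fin n => ℝ), NNReal.coe_one, one_mul, Real.dist_eq,
    Real.dist_eq]
  calc |max 0 (min s (Q.len i)) - max 0 (min t (Q.len i))|
      ≤ |min s (Q.len i) - min t (Q.len i)| := by
        have := abs_max_sub_max_le_abs (min s (Q.len i)) (min t (Q.len i)) 0
        rwa [max_comm 0, max_comm 0]
    _ ≤ |s - t| := by
        have := abs_min_sub_min_le_max s (Q.len i) t (Q.len i)
        simpa using this

lemma continuous_arc (i : Fin n) : Continuous (Q.arc i) := (Q.lipschitzWith_arc i).continuous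

lemma dist_arc_leaf_same {i : Fin n} {t : ℝ} (ht : 0 ≤ t) (ht' : t ≤ Q.len i) :
    dist (Q.arc i t) (Q.leaf i) = Q.len i - t := by
  rw [leaf, dist_arc_same Q ht ht' (Q.len_pos i).le le_rfl, abs_sub_comm, abs_of_nonneg]
  linarith

lemma dist_arc_leaf_ne {i j : Fin n} (hij : i ≠ j) {t : ℝ} (ht : 0 ≤ t) (ht' : t ≤ Q.len i) :
    dist (Q.arc i t) (Q.leaf j) = t + Q.len j := by
  rw [leaf, dist_arc_ne Q hij ht ht' (Q.len_pos j).le le_rfl]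

lemma dist_leaf_leaf {i j : Fin n} (hij : i ≠ j) :
    dist (Q.leaf i) (Q.leaf j) = Q.len i + Q.len j :=
  Q.dist_arc_leaf_ne hij (Q.len_pos i).le le_rfl

lemma dist_center_leaf (i j : Fin n) : dist (Q.arc i 0) (Q.leaf j) = Q.len j := by
  rw [Q.arc_zero i j, dist_arc_leaf_same Q le_rfl (Q.len_pos j).le, sub_zero]

/-- Points of other arcs are at distance at least ℓ_i from leaf i, with equality only at the center.
The distance from leaf i is therefore a coordinate on arc i, and it replaces case distinctions
between arcs from here on. -/
lemma eq_arc_of_dist_leaf_le {i : Fin n} {y : Q.Point} (h : dist y (Q.leaf i) ≤ Q.len i) :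
    y = Q.arc i (Q.len i - dist y (Q.leaf i)) := by
  obtain ⟨j, t, h0, h1, rfl⟩ := Q.exists_eq_arc y
  by_cases hij : j = i
  · subst hij
    rw [dist_arc_leaf_same Q h0 h1]
    congr 1
    ring
  · rw [dist_arc_leaf_ne Q hij h0 h1] at h ⊢
    obtain rfl : t = 0 := by linarith
    rw [Q.arc_zero j i]
    congr 1
    ring

lemma eq_arc_iff {i : Fin n} {t : ℝ} (h0 : 0 ≤ t) (h1 : t ≤ Q.len i) {y : Q.Point} :
    y = Q.arc i t ↔ dist y (Q.leaf i) = Q.len i - t := by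
  constructor
  · rintro rfl
    exact dist_arc_leaf_same Q h0 h1
  · intro h
    rw [eq_arc_of_dist_leaf_le Q (i := i) (y := y) (by linarith), h]
    congr 1
    ring

lemma arc_eq_arc_iff {i j : Fin n} {s t : ℝ} (hs : 0 ≤ s) (hs' : s ≤ Q.len i) (ht : 0 ≤ t)
    (ht' : t ≤ Q.len j) : Q.arc i s = Q.arc j t ↔ (i = j ∧ s = t) ∨ (s = 0 ∧ t = 0) := by
  by_cases hij : i = j
  · subst hij
    rw [Q.eq_arc_iff ht ht', dist_arc_leaf_same Q hs hs']
    constructor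
    · intro h
      exact Or.inl ⟨rfl, by linarith⟩
    · rintro (⟨-, rfl⟩ | ⟨rfl, rfl⟩) <;> rfl
  · rw [Q.eq_arc_iff ht ht', dist_arc_leaf_ne Q hij hs hs']
    constructor
    · intro h
      exact Or.inr ⟨by linarith, by linarith⟩
    · rintro (⟨h, -⟩ | ⟨rfl, rfl⟩)
      · exact absurd h hij
      · ring

lemma leaf_ne_center (i j : Fin n) : Q.leaf i ≠ Q.arc j 0 := by
  intro h
  have := Q.dist_center_leaf j i
  rw [← h, dist_self] at this
  exact (Q.len_pos i).ne this

/-- Hence the open balls of radius ℓ_i around the leaves are disjoint; all disjointness arguments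
for pieces near different leaves rest on this. -/
lemma len_add_len_le_dist_leaf {i j : Fin n} (hij : i ≠ j) (y : Q.Point) :
    Q.len i + Q.len j ≤ dist y (Q.leaf i) + dist y (Q.leaf j) := by
  rw [← Q.dist_leaf_leaf hij]
  exact dist_triangle_left _ _ _

lemma continuous_dist_leaf (i : Fin n) : Continuous fun y : Q.Point => dist y (Q.leaf i) :=
  continuous_id.dist continuous_const

lemma measurable_arc (i : Fin n) : Measurable (Q.arc i) := (Q.continuous_arc i).measurable

lemma totalLength_pos (hn : 0 < n) : 0 < Q.totalLength :=
  Finset.sum_pos (fun i _ => Q.len_pos i) ⟨⟨0, hn⟩, Finset.mem_univ _⟩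

lemma len_le_totalLength (i : Fin n) : Q.len i ≤ Q.totalLength :=
  Finset.single_le_sum (f := Q.len) (fun j _ => (Q.len_pos j).le) (Finset.mem_univ i)

/-! ### Lengths of sets -/

lemma length_apply {B : Set Q.Point} (hB : MeasurableSet B) :
    Q.length B = ∑ i, volume (Q.arc i ⁻¹' B ∩ Icc 0 (Q.len i)) := by
  rw [length, Measure.finsetSum_apply]
  refine Finset.sum_congr rfl fun i _ => ?_
  rw [Measure.map_apply (Q.measurable_arc i) hB,
    Measure.restrict_apply (Q.measurable_arc i hB)]

lemma length_univ : Q.length univ = ENNReal.ofReal Q.totalLength := by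
  rw [length_apply Q MeasurableSet.univ, totalLength,
    ENNReal.ofReal_sum_of_nonneg fun i _ => (Q.len_pos i).le]
  simp

instance : IsFiniteMeasure Q.length :=
  ⟨by rw [length_univ]; exact ENNReal.ofReal_lt_top⟩

/-- The length of a set whose intersection with each arc `j` is, up to end points, the part at
distance at least `a j` from the center. -/
lemma length_eq_sum {B : Set Q.Point} (hB : MeasurableSet B) (a : Fin n → ℝ)
    (ha0 : ∀ j, 0 ≤ a j) (ha1 : ∀ j, a j ≤ Q.len j)
    (hin : ∀ j, ∀ t, a j < t → t < Q.len j → Q.arc j t ∈ B)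
    (hout : ∀ j, ∀ t, 0 < t → t < a j → Q.arc j t ∉ B) :
    Q.length B = ENNReal.ofReal (∑ j, (Q.len j - a j)) := by
  rw [length_apply Q hB, ENNReal.ofReal_sum_of_nonneg fun i _ => by linarith [ha1 i]]
  refine Finset.sum_congr rfl fun i _ => le_antisymm ?_ ?_
  · calc volume (Q.arc i ⁻¹' B ∩ Icc 0 (Q.len i)) ≤ volume ({0} ∪ Icc (a i) (Q.len i)) := by
          refine measure_mono fun t ⟨h1, h2⟩ => ?_
          by_cases h : t < a i
          · left
            rcases h2.1.eq_or_lt with h0 | h0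
            · exact h0.symm
            · exact absurd h1 (hout i t h0 h)
          · exact Or.inr ⟨not_lt.1 h, h2.2⟩
      _ ≤ volume {(0 : ℝ)} + volume (Icc (a i) (Q.len i)) := measure_union_le _ _
      _ = _ := by simp
  · calc ENNReal.ofReal (Q.len i - a i) = volume (Ioo (a i) (Q.len i)) := by simp
      _ ≤ volume (Q.arc i ⁻¹' B ∩ Icc 0 (Q.len i)) := measure_mono fun t ht =>
        ⟨hin i t ht.1 ht.2, (ha0 i).trans ht.1.le, ht.2.le⟩

/-! ### Packing visits of leaves into a time interval -/

/-- Disjoint intervals of radius `c j` around `t j` inside `[a, b]`. -/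
lemma sum_two_mul_le_of_separated {ι : Type*} (s : Finset ι) (t c : ι → ℝ) {a b : ℝ} (hab : a ≤ b)
    (ha : ∀ j ∈ s, a + c j ≤ t j) (hb : ∀ j ∈ s, t j + c j ≤ b) (hc : ∀ j ∈ s, 0 ≤ c j)
    (hsep : ∀ j ∈ s, ∀ k ∈ s, j ≠ k → c j + c k ≤ |t j - t k|) :
    ∑ j ∈ s, 2 * c j ≤ b - a := by
  have hd : (s : Set ι).PairwiseDisjoint fun j => Ioo (t j - c j) (t j + c j) := by
    intro j hj k hk hjk
    refine Set.disjoint_left.2 fun u hu hu' => ?_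
    have h1 := hsep j hj k hk hjk
    simp only [mem_Ioo] at hu hu'
    rcases abs_cases (t j - t k) with ⟨h, _⟩ | ⟨h, _⟩ <;> rw [h] at h1 <;> linarith
  have h := measure_biUnion_finset hd (fun j _ => measurableSet_Ioo) (μ := (volume : Measure ℝ))
  have h2 : volume (⋃ j ∈ s, Ioo (t j - c j) (t j + c j)) ≤ volume (Icc a b) := by
    refine measure_mono (iUnion₂_subset fun j hj u hu => ?_)
    simp only [mem_Ioo] at hu
    exact ⟨by linarith [ha j hj], by linarith [hb j hj]⟩
  rw [h] at h2
  simp only [Real.volume_Ioo, Real.volume_Icc] at h2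
  rw [← ENNReal.ofReal_sum_of_nonneg, ENNReal.ofReal_le_ofReal_iff (by linarith)] at h2
  · refine le_trans (le_of_eq ?_) h2
    exact Finset.sum_congr rfl fun j _ => by ring
  · intro j hj
    linarith [hc j hj]

lemma ClosedPath.dist_le {Q : StarNetwork n} (S : Q.ClosedPath) (t u : ℝ) :
    dist (S.toFun t) (S.toFun u) ≤ |t - u| := by
  simpa [Real.dist_eq] using S.lipschitz.dist_le_mul t u

lemma ClosedPath.continuous {Q : StarNetwork n} (S : Q.ClosedPath) : Continuous S.toFun :=
  S.lipschitz.continuous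

/-- A time in `[a, a + L]` with a prescribed position. -/
lemma ClosedPath.IsTour.exists_mem_Icc {Q : StarNetwork n} {S : Q.ClosedPath} (hS : S.IsTour)
    (x : Q.Point) (a : ℝ) : ∃ t ∈ Ico a (a + S.period), S.toFun t = x := by
  obtain ⟨t, -, rfl⟩ := hS x
  obtain ⟨u, hu, h⟩ := S.periodic.exists_mem_Ico S.period_pos t a
  exact ⟨u, hu, h.symm⟩

/-- A tour of the star takes at least twice the length of the star. -/
lemma ClosedPath.IsTour.two_mul_totalLength_le {Q : StarNetwork n} {S : Q.ClosedPath}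
    (hn : 0 < n) (hS : S.IsTour) : 2 * Q.totalLength ≤ S.period := by
  obtain ⟨a, -, ha⟩ := hS (Q.arc ⟨0, hn⟩ 0)
  choose t ht htx using fun j => hS.exists_mem_Icc (Q.leaf j) a
  have ha' : S.toFun (a + S.period) = Q.arc ⟨0, hn⟩ 0 := by rw [S.periodic, ha]
  -- Between two passages through the center, the visit to leaf j needs ℓ_j on either side, and
  -- different leaves are ℓ_j + ℓ_k apart.
  have h := sum_two_mul_le_of_separated Finset.univ t Q.len (a := a) (b := a + S.period)
    (by linarith [S.period_pos]) (fun j _ => ?_) (fun j _ => ?_) (fun j _ => (Q.len_pos j).le)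
    (fun j _ k _ hjk => ?_)
  · rw [← Finset.mul_sum] at h
    simpa [totalLength] using h
  · have h := S.dist_le a (t j)
    rw [ha, htx, dist_center_leaf, abs_sub_comm, abs_of_nonneg (by linarith [(ht j).1])] at h
    linarith
  · have h := S.dist_le (a + S.period) (t j)
    rw [ha', htx, dist_center_leaf, abs_of_nonneg (by linarith [(ht j).2])] at h
    linarith
  · have h := S.dist_le (t j) (t k)
    rwa [htx, htx, dist_leaf_leaf Q hjk] at h

end Geometry

/-! ### The extremity set, its closure, and their components -/

section ExtremitySet

variable {n : ℕ} (Q : StarNetwork n)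

/-! ### Open and closed neighbourhoods of leaves -/

lemma leafBall_subset_arc {i : Fin n} {c : ℝ} (hc : c ≤ Q.len i) :
    {y | dist y (Q.leaf i) < c} ⊆ Q.arc i '' Ioc (Q.len i - c) (Q.len i) := fun y hy =>
  ⟨Q.len i - dist y (Q.leaf i), ⟨by linarith [mem_ofPred.1 hy],
    by linarith [dist_nonneg (x := y) (y := Q.leaf i)]⟩, (Q.eq_arc_of_dist_leaf_le (le_trans (le_of_lt hy) hc)).symm⟩

lemma arc_mem_leafBall {i : Fin n} {t c : ℝ} (h0 : 0 ≤ t) (h1 : t ≤ Q.len i)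
    (h : Q.len i - c < t) : dist (Q.arc i t) (Q.leaf i) < c := by
  rw [dist_arc_leaf_same Q h0 h1]
  linarith

lemma length_leafBall {i : Fin n} {c : ℝ} (hc0 : 0 ≤ c) (hc : c ≤ Q.len i) :
    Q.length {y | dist y (Q.leaf i) < c} = ENNReal.ofReal c := by
  rw [length_eq_sum Q (measurableSet_lt (Q.continuous_dist_leaf i).measurable measurable_const)
    (fun j => if j = i then Q.len i - c else Q.len j)]
  · rw [Finset.sum_eq_single i]
    · simp
    · intro j _ hj
      simp [hj]
    · simp
  · intro j
    split_ifs
    · linarith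
    · exact (Q.len_pos j).le
  · intro j
    split_ifs with h
    · subst h; linarith
    · exact le_rfl
  · intro j t h1 h2
    split_ifs at h1 with h
    · subst h
      exact Q.arc_mem_leafBall (by linarith) h2.le h1
    · linarith
  · intro j t h1 h2 h3
    simp only [mem_ofPred_eq] at h3
    split_ifs at h2 with h
    · subst h
      rw [dist_arc_leaf_same Q h1.le (by linarith)] at h3
      linarith
    · rw [dist_arc_leaf_ne Q h h1.le h2.le] at h3
      linarith

lemma length_leafClosedBall {i : Fin n} {c : ℝ} (hc0 : 0 ≤ c) (hc : c ≤ Q.len i) :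
    Q.length {y | dist y (Q.leaf i) ≤ c} = ENNReal.ofReal c := by
  rw [length_eq_sum Q (measurableSet_le (Q.continuous_dist_leaf i).measurable measurable_const)
    (fun j => if j = i then Q.len i - c else Q.len j)]
  · rw [Finset.sum_eq_single i]
    · simp
    · intro j _ hj
      simp [hj]
    · simp
  · intro j
    split_ifs
    · linarith
    · exact (Q.len_pos j).le
  · intro j
    split_ifs with h
    · subst h; linarith
    · exact le_rfl
  · intro j t h1 h2
    split_ifs at h1 with h
    · subst h
      exact (Q.arc_mem_leafBall (by linarith) h2.le h1).le
    · linarith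
  · intro j t h1 h2 h3
    simp only [mem_ofPred_eq] at h3
    split_ifs at h2 with h
    · subst h
      rw [dist_arc_leaf_same Q h1.le (by linarith)] at h3
      linarith
    · rw [dist_arc_leaf_ne Q h h1.le h2.le] at h3
      linarith

lemma isPreconnected_leafBall {i : Fin n} {c : ℝ} (hc : c ≤ Q.len i) :
    IsPreconnected {y | dist y (Q.leaf i) < c} := by
  rw [(Q.leafBall_subset_arc hc).antisymm]
  · exact isPreconnected_Ioc.image _ (Q.continuous_arc i).continuousOn
  · rintro _ ⟨t, ht, rfl⟩
    exact Q.arc_mem_leafBall (by linarith [ht.1]) ht.2 ht.1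

lemma isPreconnected_setOf_lt_dist_leaf {i : Fin n} {c : ℝ} (hc : c < Q.len i) :
    IsPreconnected {y | c < dist y (Q.leaf i)} := by
  refine isPreconnected_of_forall (Q.arc i 0) fun y hy => ?_
  obtain ⟨j, t, h0, h1, rfl⟩ := Q.exists_eq_arc y
  refine ⟨Q.arc j '' Icc 0 t, ?_, ⟨0, ⟨le_rfl, h0⟩, Q.arc_zero j i⟩, ⟨t, ⟨h0, le_rfl⟩, rfl⟩,
    isPreconnected_Icc.image _ (Q.continuous_arc j).continuousOn⟩
  rintro _ ⟨s, hs, rfl⟩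
  simp only [mem_ofPred_eq] at hy ⊢
  by_cases hij : j = i
  · subst hij
    rw [dist_arc_leaf_same Q h0 h1] at hy
    rw [dist_arc_leaf_same Q hs.1 (hs.2.trans h1)]
    linarith [hs.2]
  · rw [dist_arc_leaf_ne Q hij hs.1 (hs.2.trans h1)]
    linarith [hs.1]

/-! ### The extremity set -/

/-- The length of the part of arc `i` that lies in the extremity set. -/
def extremityLength (α : ℝ) (i : Fin n) : ℝ := min (α / 2) (Q.len i)

variable {α : ℝ}

lemma extremityLength_pos (hα : 0 < α) (i : Fin n) : 0 < Q.extremityLength α i :=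
  lt_min (by linarith) (Q.len_pos i)

lemma extremityLength_le_len (i : Fin n) : Q.extremityLength α i ≤ Q.len i := min_le_right _ _

lemma extremityLength_le_half (i : Fin n) : Q.extremityLength α i ≤ α / 2 := min_le_left _ _

/-- If the arcs are short relative to the attack duration or to the star, then the extremity set
is determined by the distance from the leaves. -/
theorem leafCondition (h : Q.IsBalanced ∨ ∀ i, 2 * Q.len i ≤ α) :
    Q.LeafCondition α := by
  -- If the side of x containing the center is shorter than α/2, so is the leaf side: under balance
  -- the leaf side is the shorter one, and if 2ℓ_i ≤ α it is short anyway.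
  have key : ∀ i t, 0 < t → t < Q.len i →
      Q.totalLength - (Q.len i - t) < α / 2 → Q.len i - t < α / 2 := by
    intro i t h0 h1 h2
    rcases h with h | h
    · have := h i
      linarith
    · have := h i
      linarith
  ext x
  simp only [extremitySet, IsRegular, mem_ofPred_eq]
  constructor
  · rintro ⟨⟨i, t, h0, h1, rfl⟩, y, hy, hlen⟩
    refine ⟨i, t, h0, h1, rfl, ?_⟩
    have hx : dist (Q.arc i t) (Q.leaf i) = Q.len i - t := Q.dist_arc_leaf_same h0.le h1.le
    rw [hx]
    have hy' : dist y (Q.leaf i) ≠ Q.len i - t := fun h' =>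
      hy ((Q.eq_arc_iff h0.le h1.le).2 h')
    have hα : 0 < α := by
      by_contra hα
      rw [ENNReal.ofReal_of_nonpos (by linarith)] at hlen
      exact not_lt_bot hlen
    rcases lt_or_gt_of_ne hy' with hy' | hy'
    · have hsub := (Q.isPreconnected_leafBall (i := i) (c := Q.len i - t)
        (by linarith)).subset_connectedComponentIn (x := y) hy'
        (F := {Q.arc i t}ᶜ) (fun z hz hz' => by
          rw [mem_singleton_iff] at hz'
          subst hz'
          exact (lt_irrefl _) (hx ▸ (mem_ofPred.1 hz)))
      have := (measure_mono hsub).trans_lt hlen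
      rw [length_leafBall Q (by linarith) (by linarith),
        ENNReal.ofReal_lt_ofReal_iff (by linarith)] at this
      exact this
    · have hsub := (Q.isPreconnected_setOf_lt_dist_leaf (i := i) (c := Q.len i - t)
        (by linarith)).subset_connectedComponentIn (x := y) hy'
        (F := {Q.arc i t}ᶜ) (fun z hz hz' => by
          rw [mem_singleton_iff] at hz'
          subst hz'
          exact (lt_irrefl _) (hx ▸ (mem_ofPred.1 hz)))
      have := (measure_mono hsub).trans_lt hlen
      have hc : {y | Q.len i - t < dist y (Q.leaf i)} = {y | dist y (Q.leaf i) ≤ Q.len i - t}ᶜ := by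
        ext z; simp
      rw [hc, measure_compl (measurableSet_le (Q.continuous_dist_leaf i).measurable
        measurable_const) (measure_ne_top _ _), length_univ,
        length_leafClosedBall Q (by linarith) (by linarith),
        ← ENNReal.ofReal_sub _ (by linarith), ENNReal.ofReal_lt_ofReal_iff (by linarith)] at this
      exact key i t h0 h1 this
  · rintro ⟨i, t, h0, h1, rfl, hd⟩
    have hx : dist (Q.arc i t) (Q.leaf i) = Q.len i - t := Q.dist_arc_leaf_same h0.le h1.le
    rw [hx] at hd
    have hne : Q.leaf i ≠ Q.arc i t := fun h' => by
      rw [← h', dist_self] at hx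
      linarith
    refine ⟨⟨i, t, h0, h1, rfl⟩, Q.leaf i, hne, ?_⟩
    -- A connected set that leaves the ball crosses the level ℓ_i - t of the distance from leaf i,
    -- and the only point at that level is x itself.
    have hsub : connectedComponentIn {Q.arc i t}ᶜ (Q.leaf i) ⊆
        {y | dist y (Q.leaf i) < Q.len i - t} := by
      intro z hz
      by_contra hz'
      simp only [mem_ofPred_eq, not_lt] at hz'
      obtain ⟨w, hw, hw'⟩ := isPreconnected_connectedComponentIn.intermediate_value
        (mem_connectedComponentIn (F := {Q.arc i t}ᶜ) (x := Q.leaf i) hne) hz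
        (Q.continuous_dist_leaf i).continuousOn
        (show Q.len i - t ∈ _ from ⟨by simp [h1.le], hz'⟩)
      exact connectedComponentIn_subset _ _ hw ((Q.eq_arc_iff h0.le h1.le).2 hw')
    refine (measure_mono hsub).trans_lt ?_
    rw [length_leafBall Q (by linarith) (by linarith)]
    exact (ENNReal.ofReal_lt_ofReal_iff (by linarith)).2 hd

variable {Q}

/-- Under the leaf condition, the extremity set is the union of punctured leaf neighbourhoods. -/
lemma LeafCondition.mem_extremitySet_iff (hQ : Q.LeafCondition α) {x : Q.Point} :
    x ∈ Q.extremitySet α ↔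
      ∃ i, 0 < dist x (Q.leaf i) ∧ dist x (Q.leaf i) < Q.extremityLength α i := by
  rw [hQ, mem_ofPred_eq]
  constructor
  · rintro ⟨i, t, h0, h1, rfl, hd⟩
    rw [dist_arc_leaf_same Q h0.le h1.le] at hd
    refine ⟨i, ?_⟩
    rw [dist_arc_leaf_same Q h0.le h1.le]
    exact ⟨by linarith, lt_min hd (by linarith)⟩
  · rintro ⟨i, h0, h1⟩
    have h2 := h1.trans_le (Q.extremityLength_le_len i)
    exact ⟨i, Q.len i - dist x (Q.leaf i), by linarith, by linarith,
      Q.eq_arc_of_dist_leaf_le h2.le, h1.trans_le (Q.extremityLength_le_half i)⟩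

lemma LeafCondition.isOpen_extremitySet (hQ : Q.LeafCondition α) :
    IsOpen (Q.extremitySet α) := by
  have : Q.extremitySet α = ⋃ i, {x | 0 < dist x (Q.leaf i)} ∩
      {x | dist x (Q.leaf i) < Q.extremityLength α i} := by
    ext x
    simp [hQ.mem_extremitySet_iff]
  rw [this]
  exact isOpen_iUnion fun i => (isOpen_lt continuous_const (Q.continuous_dist_leaf i)).inter
    (isOpen_lt (Q.continuous_dist_leaf i) continuous_const)

lemma LeafCondition.length_extremitySet (hQ : Q.LeafCondition α) (hα : 0 < α) :
    Q.length.real (Q.extremitySet α) = ∑ i, Q.extremityLength α i := by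
  rw [measureReal_def, length_eq_sum Q hQ.isOpen_extremitySet.measurableSet
    (fun j => Q.len j - Q.extremityLength α j) (fun j => sub_nonneg.2 (Q.extremityLength_le_len j))
    (fun j => by linarith [Q.extremityLength_pos hα j]),
    ENNReal.toReal_ofReal (Finset.sum_nonneg fun j _ => by
      linarith [Q.extremityLength_pos hα j])]
  · simp
  · intro j t h1 h2
    have h0 : 0 < t := by linarith [Q.extremityLength_le_len (α := α) j]
    rw [hQ.mem_extremitySet_iff]
    refine ⟨j, ?_⟩
    rw [dist_arc_leaf_same Q h0.le h2.le]
    constructor <;> linarith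
  · intro j t h1 h2 h3
    have h4 : t ≤ Q.len j := by linarith [Q.extremityLength_pos hα j]
    rw [hQ.mem_extremitySet_iff] at h3
    obtain ⟨i, h5, h6⟩ := h3
    by_cases hij : j = i
    · subst hij
      rw [dist_arc_leaf_same Q h1.le h4] at h6
      linarith
    · rw [dist_arc_leaf_ne Q hij h1.le h4] at h6
      linarith [Q.extremityLength_le_len (α := α) i]

/-- The boundary of a leaf component does not meet the extremity set. -/
lemma LeafCondition.dist_leaf_ne (hQ : Q.LeafCondition α) {x : Q.Point}
    (hx : x ∈ Q.extremitySet α) (i : Fin n) : dist x (Q.leaf i) ≠ Q.extremityLength α i := by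
  obtain ⟨j, h1, h2⟩ := hQ.mem_extremitySet_iff.1 hx
  by_cases hij : j = i
  · subst hij
    exact h2.ne
  · have := Q.len_add_len_le_dist_leaf hij x
    have h3 := Q.extremityLength_le_len (α := α) i
    have h4 := Q.extremityLength_le_len (α := α) j
    exact (by linarith : Q.extremityLength α i < dist x (Q.leaf i)).ne'

lemma isPreconnected_puncturedLeafBall (i : Fin n) :
    IsPreconnected {x | 0 < dist x (Q.leaf i) ∧ dist x (Q.leaf i) < Q.extremityLength α i} := by
  have h3 := Q.extremityLength_le_len (α := α) i
  convert isPreconnected_Ioo.image (Q.arc i) (Q.continuous_arc i).continuousOn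
    (s := Ioo (Q.len i - Q.extremityLength α i) (Q.len i)) using 1
  ext y
  constructor
  · rintro ⟨h1, h2⟩
    exact ⟨Q.len i - dist y (Q.leaf i), ⟨by linarith, by linarith⟩,
      (Q.eq_arc_of_dist_leaf_le (by linarith)).symm⟩
  · rintro ⟨t, ⟨h1, h2⟩, rfl⟩
    rw [mem_ofPred_eq, dist_arc_leaf_same Q (by linarith) h2.le]
    constructor <;> linarith

lemma leafClosedBall_subset_closure (hα : 0 < α) (i : Fin n) :
    {x | dist x (Q.leaf i) ≤ Q.extremityLength α i} ⊆
      closure {x | 0 < dist x (Q.leaf i) ∧ dist x (Q.leaf i) < Q.extremityLength α i} := by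
  intro y hy
  have h3 := Q.extremityLength_le_len (α := α) i
  have h4 := Q.extremityLength_pos hα i
  have h5 : (Q.len i - dist y (Q.leaf i)) ∈ closure
      (Ioo (Q.len i - Q.extremityLength α i) (Q.len i)) := by
    rw [closure_Ioo (by linarith)]
    exact ⟨by linarith [mem_ofPred.1 hy], by linarith [dist_nonneg (x := y) (y := Q.leaf i)]⟩
  rw [Q.eq_arc_of_dist_leaf_le (le_trans hy h3)]
  refine closure_mono ?_ (image_closure_subset_closure_image (Q.continuous_arc i)
    (mem_image_of_mem _ h5))
  rintro _ ⟨t, ⟨h1, h2⟩, rfl⟩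
  rw [mem_ofPred_eq, dist_arc_leaf_same Q (by linarith) h2.le]
  constructor <;> linarith

/-- The component of the extremity set at a leaf. -/
lemma LeafCondition.leafComponent_eq (hQ : Q.LeafCondition α) (hα : 0 < α) (i : Fin n) :
    Q.leafComponent α i =
      {x | 0 < dist x (Q.leaf i) ∧ dist x (Q.leaf i) < Q.extremityLength α i} := by
  -- E has no point at distance exactly c_j from leaf j, so a component that starts inside this
  -- radius cannot leave it.
  have hcomp : ∀ j y, 0 < dist y (Q.leaf j) → dist y (Q.leaf j) < Q.extremityLength α j →
      ∀ z ∈ connectedComponentIn (Q.extremitySet α) y,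
        dist z (Q.leaf j) < Q.extremityLength α j := by
    intro j y h1 h2 z hz
    by_contra hz'
    rw [not_lt] at hz'
    obtain ⟨w, hw, hw'⟩ := isPreconnected_connectedComponentIn.intermediate_value
        (mem_connectedComponentIn (hQ.mem_extremitySet_iff.2 ⟨j, h1, h2⟩)) hz
        (Q.continuous_dist_leaf j).continuousOn
        (show Q.extremityLength α j ∈ _ from ⟨h2.le, hz'⟩)
    exact hQ.dist_leaf_ne (connectedComponentIn_subset _ _ hw) j hw'
  ext y
  simp only [leafComponent, mem_ofPred_eq]
  constructor
  · rintro ⟨hy, hcl⟩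
    obtain ⟨j, h1, h2⟩ := hQ.mem_extremitySet_iff.1 hy
    by_cases hij : i = j
    · subst hij
      exact ⟨h1, h2⟩
    · exfalso
      have hsub : closure (connectedComponentIn (Q.extremitySet α) y) ⊆
          {z | dist z (Q.leaf j) ≤ Q.extremityLength α j} :=
        closure_minimal (fun z hz => (hcomp j y h1 h2 z hz).le)
          (isClosed_le (Q.continuous_dist_leaf j) continuous_const)
      have := hsub hcl
      rw [mem_ofPred_eq, dist_leaf_leaf Q hij] at this
      linarith [Q.extremityLength_le_len (α := α) j, Q.len_pos i]
  · rintro ⟨h1, h2⟩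
    refine ⟨hQ.mem_extremitySet_iff.2 ⟨i, h1, h2⟩, ?_⟩
    refine closure_mono ((isPreconnected_puncturedLeafBall i).subset_connectedComponentIn
      ⟨h1, h2⟩ fun z hz => hQ.mem_extremitySet_iff.2 ⟨i, hz⟩)
      (leafClosedBall_subset_closure hα i ?_)
    simp [(Q.extremityLength_pos hα i).le]

lemma LeafCondition.leafComponentLength_eq (hQ : Q.LeafCondition α) (hα : 0 < α) (i : Fin n) :
    Q.leafComponentLength α i = Q.extremityLength α i := by
  have h4 := Q.extremityLength_pos hα i
  rw [leafComponentLength, hQ.leafComponent_eq hα, measureReal_def,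
    length_eq_sum Q _ (fun j => if j = i then Q.len i - Q.extremityLength α i else Q.len j)]
  · rw [Finset.sum_eq_single i]
    · simp [h4.le]
    · intro j _ hj
      simp [hj]
    · simp
  · intro j
    split_ifs
    · linarith [Q.extremityLength_le_len (α := α) i]
    · exact (Q.len_pos j).le
  · intro j
    split_ifs with h
    · subst h; linarith
    · exact le_rfl
  · intro j t h1 h2
    split_ifs at h1 with h
    · subst h
      rw [mem_ofPred_eq, dist_arc_leaf_same Q
        (by linarith [Q.extremityLength_le_len (α := α) j]) h2.le]
      constructor <;> linarith
    · linarith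
  · intro j t h1 h2 h3
    split_ifs at h2 with h
    · subst h
      rw [mem_ofPred_eq, dist_arc_leaf_same Q h1.le (by linarith)] at h3
      linarith
    · rw [mem_ofPred_eq, dist_arc_leaf_ne Q h h1.le h2.le] at h3
      linarith [Q.extremityLength_le_len (α := α) i]
  · exact (measurableSet_lt measurable_const (Q.continuous_dist_leaf i).measurable).inter
      (measurableSet_lt (Q.continuous_dist_leaf i).measurable measurable_const)

/-! ### The closure of the extremity set and its components -/

lemma LeafCondition.mem_closure_extremitySet_iff (hQ : Q.LeafCondition α) (hα : 0 < α)
    {x : Q.Point} : x ∈ closure (Q.extremitySet α) ↔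
      ∃ i, dist x (Q.leaf i) ≤ Q.extremityLength α i := by
  constructor
  · have : closure (Q.extremitySet α) ⊆ ⋃ i, {x | dist x (Q.leaf i) ≤ Q.extremityLength α i} :=
      closure_minimal (fun z hz => by
        obtain ⟨i, -, h⟩ := hQ.mem_extremitySet_iff.1 hz
        exact mem_iUnion.2 ⟨i, h.le⟩)
        (isClosed_iUnion_of_finite fun i => isClosed_le (Q.continuous_dist_leaf i)
          continuous_const)
    intro h
    exact mem_iUnion.1 (this h)
  · rintro ⟨i, hi⟩
    exact closure_mono (fun z hz => hQ.mem_extremitySet_iff.2 ⟨i, hz⟩)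
      (leafClosedBall_subset_closure hα i hi)

/-- The union of the arcs that lie in the closure of the extremity set. -/
def shortArcs (Q : StarNetwork n) (α : ℝ) : Set Q.Point :=
  {x | ∃ i, Q.len i ≤ α / 2 ∧ dist x (Q.leaf i) ≤ Q.len i}

/-- The component of the closure of the extremity set that contains leaf `i`. -/
def closureComponent (Q : StarNetwork n) (α : ℝ) (i : Fin n) : Set Q.Point :=
  {x | (α / 2 < Q.len i ∧ dist x (Q.leaf i) ≤ α / 2) ∨ (Q.len i ≤ α / 2 ∧ x ∈ Q.shortArcs α)}

lemma closureComponent_of_lt {i : Fin n} (hi : α / 2 < Q.len i) :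
    Q.closureComponent α i = {x | dist x (Q.leaf i) ≤ α / 2} := by
  ext x
  simp [closureComponent, hi, hi.not_ge]

lemma closureComponent_of_le {i : Fin n} (hi : Q.len i ≤ α / 2) :
    Q.closureComponent α i = Q.shortArcs α := by
  ext x
  simp [closureComponent, hi, hi.not_gt]

lemma isClosed_shortArcs : IsClosed (Q.shortArcs α) := by
  have : Q.shortArcs α = ⋃ i ∈ {i | Q.len i ≤ α / 2}, {x | dist x (Q.leaf i) ≤ Q.len i} := by
    ext x
    simp [shortArcs]
  rw [this]
  exact (Set.toFinite _).isClosed_biUnion fun i _ =>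
    isClosed_le (Q.continuous_dist_leaf i) continuous_const

lemma isClosed_closureComponent (i : Fin n) : IsClosed (Q.closureComponent α i) := by
  rcases lt_or_ge (α / 2) (Q.len i) with hi | hi
  · rw [closureComponent_of_lt hi]
    exact isClosed_le (Q.continuous_dist_leaf i) continuous_const
  · rw [closureComponent_of_le hi]
    exact isClosed_shortArcs

/-- All short arcs contain the center, which glues them into one component of the closure of E. The
pieces at the leaves of long arcs stay away from the center. -/
lemma isPreconnected_shortArcs : IsPreconnected (Q.shortArcs α) := by
  rcases (Q.shortArcs α).eq_empty_or_nonempty with h | ⟨-, i, hi, -⟩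
  · rw [h]
    exact isPreconnected_empty
  refine isPreconnected_of_forall (Q.arc i 0) fun y hy => ?_
  obtain ⟨j, hj, hd⟩ := hy
  refine ⟨Q.arc j '' Icc 0 (Q.len j), ?_, ⟨0, ⟨le_rfl, (Q.len_pos j).le⟩, Q.arc_zero j i⟩, ?_,
    isPreconnected_Icc.image _ (Q.continuous_arc j).continuousOn⟩
  · rintro _ ⟨t, ht, rfl⟩
    refine ⟨j, hj, ?_⟩
    rw [dist_arc_leaf_same Q ht.1 ht.2]
    linarith [ht.1]
  · exact ⟨_, ⟨by linarith, by linarith [dist_nonneg (x := y) (y := Q.leaf j)]⟩,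
      (Q.eq_arc_of_dist_leaf_le hd).symm⟩

lemma isPreconnected_leafClosedBall {i : Fin n} {c : ℝ} (hc : c ≤ Q.len i) :
    IsPreconnected {y | dist y (Q.leaf i) ≤ c} := by
  convert isPreconnected_Icc.image (Q.arc i) (Q.continuous_arc i).continuousOn
    (s := Icc (Q.len i - c) (Q.len i)) using 1
  ext y
  constructor
  · intro h1
    exact ⟨Q.len i - dist y (Q.leaf i), ⟨by linarith [mem_ofPred.1 h1], by
      linarith [dist_nonneg (x := y) (y := Q.leaf i)]⟩,
      (Q.eq_arc_of_dist_leaf_le (le_trans h1 hc)).symm⟩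
  · rintro ⟨t, ⟨h1, h2⟩, rfl⟩
    rw [mem_ofPred_eq, dist_arc_leaf_same Q (by linarith) h2]
    linarith

lemma LeafCondition.closureComponent_subset (hQ : Q.LeafCondition α) (hα : 0 < α) (i : Fin n) :
    Q.closureComponent α i ⊆ closure (Q.extremitySet α) := by
  intro x hx
  rw [hQ.mem_closure_extremitySet_iff hα]
  rcases hx with ⟨h1, h2⟩ | ⟨-, j, h1, h2⟩
  · exact ⟨i, le_min h2 (h2.trans h1.le)⟩
  · exact ⟨j, le_min (h2.trans h1) h2⟩

lemma mem_closureComponent {i : Fin n} {x : Q.Point}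
    (hx : dist x (Q.leaf i) ≤ Q.extremityLength α i) : x ∈ Q.closureComponent α i := by
  rcases lt_or_ge (α / 2) (Q.len i) with hi | hi
  · exact Or.inl ⟨hi, hx.trans (Q.extremityLength_le_half i)⟩
  · exact Or.inr ⟨hi, i, hi, hx.trans (Q.extremityLength_le_len i)⟩

lemma LeafCondition.connectedComponentIn_eq_of_lt (hQ : Q.LeafCondition α) (hα : 0 < α)
    {i : Fin n} (hi : α / 2 < Q.len i) {x : Q.Point} (hx : dist x (Q.leaf i) ≤ α / 2) :
    connectedComponentIn (closure (Q.extremitySet α)) x = {x | dist x (Q.leaf i) ≤ α / 2} := by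
  have hsub := hQ.closureComponent_subset hα i
  rw [closureComponent_of_lt hi] at hsub
  refine subset_antisymm (fun y hy => ?_)
    ((isPreconnected_leafClosedBall hi.le).subset_connectedComponentIn hx hsub)
  by_contra hy'
  rw [mem_ofPred_eq, not_le] at hy'
  -- The closure of E has no points at distance strictly between α/2 and ℓ_i from leaf i. The
  -- minimum selects a level in this gap that the distance must take on the way to y.
  have hc : α / 2 < min (dist y (Q.leaf i)) ((α / 2 + Q.len i) / 2) :=
    lt_min hy' (by linarith)
  obtain ⟨w, hw, hw'⟩ := isPreconnected_connectedComponentIn.intermediate_value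
    (mem_connectedComponentIn (hsub hx)) hy (Q.continuous_dist_leaf i).continuousOn
    (show min (dist y (Q.leaf i)) ((α / 2 + Q.len i) / 2) ∈ _ from
      ⟨hx.trans hc.le, min_le_left _ _⟩)
  replace hw' : dist w (Q.leaf i) = _ := hw'
  have h1 : dist w (Q.leaf i) < Q.len i := by
    rw [hw']
    exact (min_le_right _ _).trans_lt (by linarith)
  rw [← hw'] at hc
  obtain ⟨j, hj⟩ := (hQ.mem_closure_extremitySet_iff hα).1 (connectedComponentIn_subset _ _ hw)
  by_cases hij : i = j
  · subst hij
    linarith [Q.extremityLength_le_half (α := α) i]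
  · have := Q.len_add_len_le_dist_leaf hij w
    linarith [Q.extremityLength_le_len (α := α) j]

lemma LeafCondition.connectedComponentIn_eq (hQ : Q.LeafCondition α) (hα : 0 < α)
    {i : Fin n} {x : Q.Point} (hx : x ∈ Q.closureComponent α i) :
    connectedComponentIn (closure (Q.extremitySet α)) x = Q.closureComponent α i := by
  rcases lt_or_ge (α / 2) (Q.len i) with hi | hi
  · rw [closureComponent_of_lt hi] at hx ⊢
    exact hQ.connectedComponentIn_eq_of_lt hα hi hx
  · have hsub := hQ.closureComponent_subset hα i
    rw [closureComponent_of_le hi] at hx hsub ⊢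
    refine subset_antisymm (fun y hy => ?_)
      (isPreconnected_shortArcs.subset_connectedComponentIn hx hsub)
    obtain ⟨j, hj⟩ := (hQ.mem_closure_extremitySet_iff hα).1
      (connectedComponentIn_subset _ _ hy)
    rcases lt_or_ge (α / 2) (Q.len j) with hj' | hj'
    · exfalso
      have hj'' := hj.trans (Q.extremityLength_le_half j)
      have h1 := hQ.connectedComponentIn_eq_of_lt hα hj' hj''
      rw [← _root_.connectedComponentIn_eq hy] at h1
      have h2 := mem_connectedComponentIn (hsub hx)
      rw [h1, mem_ofPred_eq] at h2
      obtain ⟨k, hk, hk'⟩ := hx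
      have hkj : k ≠ j := fun h => by subst h; linarith
      have := Q.len_add_len_le_dist_leaf hkj x
      linarith
    · exact ⟨j, hj', hj.trans (Q.extremityLength_le_len j)⟩

lemma leaf_mem_closureComponent (hα : 0 < α) (i : Fin n) :
    Q.leaf i ∈ Q.closureComponent α i :=
  mem_closureComponent (by rw [dist_self]; exact (Q.extremityLength_pos hα i).le)

lemma LeafCondition.closureComponents_eq (hQ : Q.LeafCondition α) (hα : 0 < α) :
    Q.closureComponents α = range (Q.closureComponent α) := by
  ext K
  constructor
  · rintro ⟨x, hx, rfl⟩
    obtain ⟨i, hi⟩ := (hQ.mem_closure_extremitySet_iff hα).1 hx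
    exact ⟨i, (hQ.connectedComponentIn_eq hα (mem_closureComponent hi)).symm⟩
  · rintro ⟨i, rfl⟩
    have := leaf_mem_closureComponent hα i (Q := Q)
    exact ⟨Q.leaf i, hQ.closureComponent_subset hα i this,
      (hQ.connectedComponentIn_eq hα this).symm⟩

lemma LeafCondition.finite_closureComponents (hQ : Q.LeafCondition α) (hα : 0 < α) :
    (Q.closureComponents α).Finite := by
  rw [hQ.closureComponents_eq hα]
  exact finite_range _

lemma eq_of_mem_closureComponents {K K' : Set Q.Point} (hK : K ∈ Q.closureComponents α)
    (hK' : K' ∈ Q.closureComponents α) {x : Q.Point} (hx : x ∈ K) (hx' : x ∈ K') : K = K' := by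
  obtain ⟨y, -, rfl⟩ := hK
  obtain ⟨y', -, rfl⟩ := hK'
  rw [connectedComponentIn_eq hx, connectedComponentIn_eq hx']

/-- The total length of the components of the closure of the extremity set. -/
lemma LeafCondition.finsum_closureComponents (hQ : Q.LeafCondition α) (hα : 0 < α) :
    ∑ᶠ K ∈ Q.closureComponents α, 2 * Q.length.real K =
      2 * Q.length.real (Q.extremitySet α) := by
  have hfin := hQ.finite_closureComponents hα
  rw [finsum_mem_eq_finite_toFinset_sum _ hfin, ← Finset.mul_sum]
  congr 1
  -- The components partition the closure, and passing from E to its closure adds no length.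
  have hU : ⋃ K ∈ hfin.toFinset, K = closure (Q.extremitySet α) := by
    ext x
    simp only [mem_iUnion, Set.Finite.mem_toFinset, exists_prop]
    constructor
    · rintro ⟨K, ⟨y, -, rfl⟩, hx⟩
      exact connectedComponentIn_subset _ _ hx
    · intro hx
      exact ⟨_, ⟨x, hx, rfl⟩, mem_connectedComponentIn hx⟩
  have hmeas : ∀ K ∈ hfin.toFinset, MeasurableSet K := by
    intro K hK
    rw [Set.Finite.mem_toFinset, hQ.closureComponents_eq hα] at hK
    obtain ⟨i, rfl⟩ := hK
    exact (isClosed_closureComponent i).measurableSet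
  rw [← measureReal_biUnion_finset (fun K hK K' hK' hne => Set.disjoint_left.2 fun x hx hx' =>
    hne (eq_of_mem_closureComponents ((Set.Finite.mem_toFinset _).1 hK)
      ((Set.Finite.mem_toFinset _).1 hK') hx hx')) hmeas, hU, hQ.length_extremitySet hα,
    measureReal_def, length_eq_sum Q isClosed_closure.measurableSet
    (fun j => Q.len j - Q.extremityLength α j) (fun j => sub_nonneg.2 (Q.extremityLength_le_len j))
    (fun j => by linarith [Q.extremityLength_pos hα j]),
    ENNReal.toReal_ofReal (Finset.sum_nonneg fun j _ => by
      linarith [Q.extremityLength_pos hα j])]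
  · simp
  · intro j t h1 h2
    have h0 : 0 < t := by linarith [Q.extremityLength_le_len (α := α) j]
    rw [hQ.mem_closure_extremitySet_iff hα]
    refine ⟨j, ?_⟩
    rw [dist_arc_leaf_same Q h0.le h2.le]
    linarith
  · intro j t h1 h2 h3
    have h4 : t ≤ Q.len j := by linarith [Q.extremityLength_pos hα j]
    rw [hQ.mem_closure_extremitySet_iff hα] at h3
    obtain ⟨i, h6⟩ := h3
    by_cases hij : j = i
    · subst hij
      rw [dist_arc_leaf_same Q h1.le h4] at h6
      linarith
    · rw [dist_arc_leaf_ne Q hij h1.le h4] at h6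
      linarith [Q.extremityLength_le_len (α := α) i]

lemma length_closureComponent_of_lt (hα : 0 < α) {i : Fin n} (hi : α / 2 < Q.len i) :
    Q.length.real (Q.closureComponent α i) = α / 2 := by
  rw [closureComponent_of_lt hi, measureReal_def, length_leafClosedBall Q (by linarith) hi.le,
    ENNReal.toReal_ofReal (by linarith)]

lemma length_shortArcs :
    Q.length.real (Q.shortArcs α) = ∑ i with Q.len i ≤ α / 2, Q.len i := by
  rw [measureReal_def, length_eq_sum Q isClosed_shortArcs.measurableSet
    (fun j => if Q.len j ≤ α / 2 then 0 else Q.len j), ENNReal.toReal_ofReal, Finset.sum_filter]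
  · refine Finset.sum_congr rfl fun j _ => ?_
    split_ifs <;> simp
  · refine Finset.sum_nonneg fun j _ => ?_
    split_ifs
    · linarith [Q.len_pos j]
    · simp
  · intro j
    split_ifs
    · exact le_rfl
    · exact (Q.len_pos j).le
  · intro j
    split_ifs
    · exact (Q.len_pos j).le
    · exact le_rfl
  · intro j t h1 h2
    split_ifs at h1 with h
    · refine ⟨j, h, ?_⟩
      rw [dist_arc_leaf_same Q h1.le h2.le]
      linarith
    · linarith
  · rintro j t h1 h2 ⟨i, h3, h4⟩
    split_ifs at h2 with h
    · linarith
    · have hij : j ≠ i := fun h' => h (h' ▸ h3)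
      rw [dist_arc_leaf_ne Q hij h1.le h2.le] at h4
      linarith

end ExtremitySet

variable {n : ℕ} {Q : StarNetwork n} {α : ℝ}

/-! ### Measurability of interception and the payoff -/

/-- The distance from the attacked point attains its minimum over the compact attack window;
approximate visits at approximately admissible times force this minimum to be 0. -/
lemma Intercepts.of_forall_near (hα : 0 < α) {S : Q.Patrol} {a : Q.Attack}
    (h : ∀ ε : ℝ, 0 < ε → ∃ q : ℝ≥0, (a.2 : ℝ) < q + ε ∧ (q : ℝ) < a.2 + α + ε ∧
      dist (S.1 q) a.1 < ε) : Q.Intercepts α S a := by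
  obtain ⟨t, ht, hmin⟩ := (isCompact_Icc (a := a.2) (b := a.2 + α.toNNReal)).exists_isMinOn
    ⟨a.2, left_mem_Icc.2 le_self_add⟩
    (f := fun t => dist (S.1 t) a.1) (S.2.continuous.dist continuous_const).continuousOn
  have hd : dist (S.1 t) a.1 = 0 := by
    by_contra hne
    have hpos : 0 < dist (S.1 t) a.1 := lt_of_le_of_ne dist_nonneg (Ne.symm hne)
    obtain ⟨q, h1, h2, h3⟩ := h (dist (S.1 t) a.1 / 2) (by linarith)
    -- Clamping q into the window moves it by less than ε, hence the patrol by less than ε.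
    have hq' : max a.2 (min q (a.2 + α.toNNReal)) ∈ Icc a.2 (a.2 + α.toNNReal) :=
      ⟨le_max_left _ _, max_le le_self_add (min_le_right _ _)⟩
    have h4 : dist (S.1 t) a.1 ≤ dist (S.1 (max a.2 (min q (a.2 + α.toNNReal)))) a.1 := hmin hq'
    have h5 := S.2.dist_le_mul (max a.2 (min q (a.2 + α.toNNReal))) q
    have h6 : dist (max a.2 (min q (a.2 + α.toNNReal))) q < dist (S.1 t) a.1 / 2 := by
      rw [NNReal.dist_eq]
      push_cast
      rw [Real.coe_toNNReal α hα.le, abs_lt]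
      constructor
      · rcases le_total (q : ℝ) (a.2 + α) with h | h
        · rw [min_eq_left h]
          linarith [le_max_right (a.2 : ℝ) q]
        · rw [min_eq_right h]
          linarith [le_max_right (a.2 : ℝ) (a.2 + α)]
      · rw [sub_lt_iff_lt_add]
        exact max_lt (by linarith) ((min_le_left _ _).trans_lt (by linarith))
    rw [NNReal.coe_one, one_mul] at h5
    linarith [dist_triangle (S.1 (max a.2 (min q (a.2 + α.toNNReal)))) (S.1 q) a.1]
  refine ⟨t, ht.1, ?_, dist_eq_zero.1 hd⟩
  have := NNReal.coe_le_coe.2 ht.2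
  push_cast at this
  rwa [Real.coe_toNNReal α hα.le] at this

/-- By the compactness criterion, interception is a countable condition on the positions at a dense
sequence of times. -/
lemma measurableSet_intercepts (hα : 0 < α) :
    MeasurableSet {p : Q.Patrol × Q.Attack | Q.Intercepts α p.1 p.2} := by
  have heq : {p : Q.Patrol × Q.Attack | Q.Intercepts α p.1 p.2} =
      ⋂ k : ℕ, ⋃ m : ℕ, {p | (p.2.2 : ℝ) < (TopologicalSpace.denseSeq ℝ≥0 m : ℝ) + 1 / (k + 1) ∧
        (TopologicalSpace.denseSeq ℝ≥0 m : ℝ) < p.2.2 + α + 1 / (k + 1) ∧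
        dist (p.1.1 (TopologicalSpace.denseSeq ℝ≥0 m)) p.2.1 < 1 / (k + 1)} := by
    ext ⟨S, a⟩
    simp only [mem_ofPred_eq, mem_iInter, mem_iUnion]
    constructor
    · rintro ⟨t, h1, h2, h3⟩ k
      have hk : (0 : ℝ) < 1 / (k + 1) := by positivity
      obtain ⟨m, hm⟩ := (TopologicalSpace.denseRange_denseSeq ℝ≥0).exists_dist_lt t hk
      have h5 := S.2.dist_le_mul (TopologicalSpace.denseSeq ℝ≥0 m) t
      rw [NNReal.coe_one, one_mul, dist_comm _ t, h3] at h5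
      refine ⟨m, ?_, ?_, h5.trans_lt hm⟩
      all_goals
        rw [NNReal.dist_eq, abs_lt] at hm
        have h1' : (a.2 : ℝ) ≤ t := h1
        linarith
    · intro h
      refine Intercepts.of_forall_near hα fun ε hε => ?_
      obtain ⟨k, hk⟩ := exists_nat_one_div_lt hε
      obtain ⟨m, h1, h2, h3⟩ := h k
      exact ⟨_, by linarith, by linarith, by linarith⟩
  rw [heq]
  refine MeasurableSet.iInter fun k => MeasurableSet.iUnion fun m => ?_
  have hS : Measurable fun p : Q.Patrol × Q.Attack =>
      p.1.1 (TopologicalSpace.denseSeq ℝ≥0 m) :=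
    (measurable_pi_apply _).comp (measurable_subtype_coe.comp measurable_fst)
  have h2 : Measurable fun p : Q.Patrol × Q.Attack => (p.2.2 : ℝ) :=
    measurable_coe_nnreal_real.comp (measurable_snd.comp measurable_snd)
  have h1 : Measurable fun p : Q.Patrol × Q.Attack => p.2.1 :=
    measurable_fst.comp measurable_snd
  exact (measurableSet_lt h2 measurable_const).inter
    ((measurableSet_lt measurable_const ((h2.add_const _).add_const _)).inter
      (measurableSet_lt (hS.dist h1) measurable_const))

lemma measurableSet_setOf_intercepts (hα : 0 < α) (S : Q.Patrol) :
    MeasurableSet {a | Q.Intercepts α S a} :=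
  measurable_prodMk_left (x := S) (measurableSet_intercepts hα)

/-- By Fubini, a bound against every pure patrol passes to mixed ones; `le_payoff` is the
counterpart for attacks. -/
lemma payoff_le (hα : 0 < α) {σ : Measure Q.Patrol} [IsProbabilityMeasure σ]
    {m : Measure Q.Attack} [SFinite m] {c : ℝ≥0∞} (h : ∀ S, m {a | Q.Intercepts α S a} ≤ c) :
    Q.payoff α σ m ≤ c := by
  rw [payoff, Measure.prod_apply (measurableSet_intercepts hα)]
  calc ∫⁻ S, m (Prod.mk S ⁻¹' {p : Q.Patrol × Q.Attack | Q.Intercepts α p.1 p.2}) ∂σ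
      ≤ ∫⁻ _, c ∂σ := lintegral_mono fun S => h S
    _ = c := by simp

lemma le_payoff (hα : 0 < α) {σ : Measure Q.Patrol} [SFinite σ]
    {m : Measure Q.Attack} [IsProbabilityMeasure m] {c : ℝ≥0∞}
    (h : ∀ a, c ≤ σ {S | Q.Intercepts α S a}) : c ≤ Q.payoff α σ m := by
  rw [payoff, Measure.prod_apply_symm (measurableSet_intercepts hα)]
  calc c = ∫⁻ _, c ∂m := by simp
    _ ≤ ∫⁻ a, σ ((fun S => (S, a)) ⁻¹' {p : Q.Patrol × Q.Attack | Q.Intercepts α p.1 p.2}) ∂m :=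
      lintegral_mono fun a => h a

lemma lowerValue_le_upperValue : Q.lowerValue α ≤ Q.upperValue α :=
  iSup_le fun σ => le_iInf fun m => (iInf_le _ m).trans
    (le_iSup (fun σ : ProbabilityMeasure Q.Patrol =>
      Q.payoff α (σ : Measure Q.Patrol) (m : Measure Q.Attack)) σ)

/-- A strategy of the Attacker bounds the upper value. -/
lemma upperValue_le (hα : 0 < α) {m : Measure Q.Attack} [hm : IsProbabilityMeasure m]
    {c : ℝ≥0∞} (h : ∀ S, m {a | Q.Intercepts α S a} ≤ c) :
    Q.upperValue α ≤ ⨆ σ : ProbabilityMeasure Q.Patrol, Q.payoff α (σ : Measure Q.Patrol) m ∧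
    ⨆ σ : ProbabilityMeasure Q.Patrol, Q.payoff α (σ : Measure Q.Patrol) m ≤ c :=
  ⟨iInf_le (fun m : ProbabilityMeasure Q.Attack =>
    ⨆ σ : ProbabilityMeasure Q.Patrol, Q.payoff α (σ : Measure Q.Patrol) (m : Measure Q.Attack))
    ⟨m, hm⟩, iSup_le fun _ => payoff_le hα h⟩

/-- A strategy of the Patroller bounds the lower value. -/
lemma le_lowerValue (hα : 0 < α) {σ : Measure Q.Patrol} [hσ : IsProbabilityMeasure σ]
    {c : ℝ≥0∞} (h : ∀ a, c ≤ σ {S | Q.Intercepts α S a}) :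
    c ≤ ⨅ m : ProbabilityMeasure Q.Attack, Q.payoff α σ (m : Measure Q.Attack) ∧
    ⨅ m : ProbabilityMeasure Q.Attack, Q.payoff α σ (m : Measure Q.Attack) ≤ Q.lowerValue α :=
  ⟨le_iInf fun _ => le_payoff hα h,
    le_iSup (fun σ : ProbabilityMeasure Q.Patrol =>
      ⨅ m : ProbabilityMeasure Q.Attack, Q.payoff α (σ : Measure Q.Patrol) (m : Measure Q.Attack))
    ⟨σ, hσ⟩⟩

/-! ### Bounds for a single path -/

/-- The image of a set of times under a unit speed path is no longer than the duration of these
times, even if leaves are added to the image. -/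
lemma length_le_volume_of_lipschitz {f : ℝ → Q.Point} (hf : LipschitzWith 1 f) {N : Set ℝ}
    (hN : MeasurableSet N) {B : Set Q.Point} (hB : MeasurableSet B)
    (hsub : ∀ x ∈ B, (∃ i, x = Q.leaf i) ∨ x ∈ f '' N) : Q.length B ≤ volume N := by
  rw [length_apply Q hB]
  set T : Fin n → Set ℝ := fun i => N ∩ {u | dist (f u) (Q.leaf i) < Q.len i} with hT
  have hTm : ∀ i, MeasurableSet (T i) := fun i =>
    hN.inter (measurableSet_lt ((Q.continuous_dist_leaf i).comp hf.continuous).measurable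
      measurable_const)
  have hdisj : Pairwise (Function.onFun Disjoint T) := by
    intro i j hij
    refine Set.disjoint_left.2 fun u hu hu' => ?_
    have := Q.len_add_len_le_dist_leaf hij (f u)
    linarith [mem_ofPred.1 hu.2, mem_ofPred.1 hu'.2]
  have key : ∀ i, volume (Q.arc i ⁻¹' B ∩ Icc 0 (Q.len i)) ≤ volume (T i) := by
    intro i
    -- While the path is on arc i, `g` is its distance from the center.
    set g : ℝ → ℝ := fun u => Q.len i - dist (f u) (Q.leaf i) with hg
    have hgl : LipschitzWith 1 g := by
      refine LipschitzWith.of_dist_le_mul fun u v => ?_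
      have h1 := hf.dist_le_mul u v
      refine le_trans ?_ h1
      rw [Real.dist_eq, abs_le]
      have h2 := dist_triangle (f u) (f v) (Q.leaf i)
      have h3 := dist_triangle (f v) (f u) (Q.leaf i)
      rw [dist_comm (f v) (f u)] at h3
      simp only [hg]
      constructor <;> linarith
    -- The two end points of an arc form a null set, so exempting leaves from the covering condition
    -- costs nothing.
    have himg : Q.arc i ⁻¹' B ∩ Icc 0 (Q.len i) ⊆ ({0, Q.len i} : Set ℝ) ∪ g '' (T i) := by
      rintro t ⟨h1, h2⟩
      rcases h2.1.eq_or_lt with h0 | h0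
      · left; left; exact h0.symm
      rcases hsub _ h1 with ⟨j, hj⟩ | ⟨u, hu, hu'⟩
      · left; right
        rcases (Q.arc_eq_arc_iff h2.1 h2.2 (Q.len_pos j).le le_rfl).1 hj with ⟨rfl, h⟩ | ⟨h, -⟩
        · exact h
        · exact absurd h h0.ne'
      · right
        have h3 := Q.dist_arc_leaf_same h2.1 h2.2
        refine ⟨u, ⟨hu, ?_⟩, ?_⟩
        · rw [mem_ofPred_eq, hu', h3]
          linarith
        · simp only [hg]
          rw [hu', h3]
          ring
    calc volume (Q.arc i ⁻¹' B ∩ Icc 0 (Q.len i))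
        ≤ volume ({0, Q.len i} : Set ℝ) + volume (g '' (T i)) :=
          (measure_mono himg).trans (measure_union_le _ _)
      _ = volume (g '' (T i)) := by
          rw [(Set.toFinite ({0, Q.len i} : Set ℝ)).measure_zero, zero_add]
      _ ≤ volume (T i) := by
          -- One-dimensional Hausdorff measure is Lebesgue measure on the line and is not increased
          -- by 1-Lipschitz maps; no measurability of the image is required.
          have := (hgl.lipschitzOnWith (s := T i)).hausdorffMeasure_image_le (d := 1) zero_le_one
          rw [hausdorffMeasure_real] at this
          simpa using this
  calc ∑ i, volume (Q.arc i ⁻¹' B ∩ Icc 0 (Q.len i)) ≤ ∑ i, volume (T i) :=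
        Finset.sum_le_sum fun i _ => key i
    _ = volume (⋃ i, T i) := by
        rw [measure_iUnion hdisj hTm, tsum_fintype]
    _ ≤ volume N := measure_mono (iUnion_subset fun i => inter_subset_left)

/-- `D` is the set of visit times of a point, `T` a set of times that contains the
`e`-neighbourhood of `D` in `[M, M + α]`. The start times within `e` of `M` of the intercepted
attacks take no more time than `T`. -/
lemma volume_intercepted_le {D T : Set ℝ} (hD : IsClosed D) {M e : ℝ} (he : 0 < e)
    (heα : 2 * e ≤ α) (hT : ∀ u ∈ D, Ioo (u - e) (u + e) ∩ Icc M (M + α) ⊆ T) :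
    volume {τ | τ ∈ Icc (M - e) (M + e) ∧ ∃ u ∈ D, τ ≤ u ∧ u ≤ τ + α} ≤ volume T := by
  -- A visit at least e inside [M, M + α] contributes a full interval of length 2e to `T`, the
  -- length of the whole window of start times.
  by_cases hmid : ∃ u ∈ D, M + e ≤ u ∧ u ≤ M + α - e
  · obtain ⟨u, hu, h1, h2⟩ := hmid
    calc _ ≤ volume (Icc (M - e) (M + e)) := measure_mono fun τ hτ => hτ.1
      _ = volume (Ioo (u - e) (u + e)) := by
        rw [Real.volume_Icc, Real.volume_Ioo]; congr 1; ring
      _ ≤ volume T := measure_mono fun v hv =>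
        hT u hu ⟨hv, by linarith [hv.1], by linarith [hv.2]⟩
  · push Not at hmid
    -- With t the last visit in [M - e, M + e], early visits intercept only start times up to t, and
    -- a = t + e makes (M, a) as long as [M - e, t]. The choice of `b` below is the mirror image,
    -- with the first visit near M + α.
    obtain ⟨a, ha0, ha1, haT, ha⟩ : ∃ a, M ≤ a ∧ a ≤ M + 2 * e ∧ Ioo M a ⊆ T ∧
        ∀ u ∈ D, M - e ≤ u → u ≤ M + e → u ≤ a - e := by
      rcases (D ∩ Icc (M - e) (M + e)).eq_empty_or_nonempty with h | h
      · refine ⟨M, le_rfl, by linarith, by simp, fun u hu h1 h2 => ?_⟩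
        have : u ∈ D ∩ Icc (M - e) (M + e) := ⟨hu, h1, h2⟩
        rw [h] at this
        exact this.elim
      · obtain ⟨t, ⟨ht, ht'⟩, hmax⟩ :=
          (isCompact_Icc.inter_left hD).exists_isGreatest h
        refine ⟨t + e, by linarith [ht'.1], by linarith [ht'.2], fun v hv => ?_,
          fun u hu h1 h2 => ?_⟩
        · exact hT t ht ⟨⟨by linarith [ht'.2, hv.1], hv.2⟩, hv.1.le,
            by linarith [hv.2, ht'.2]⟩
        · linarith [hmax ⟨hu, h1, h2⟩]
    obtain ⟨b, hb0, hb1, hbT, hb⟩ : ∃ b, M + α - 2 * e ≤ b ∧ b ≤ M + α ∧ Ioo b (M + α) ⊆ T ∧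
        ∀ u ∈ D, M + α - e ≤ u → u ≤ M + α + e → b + e ≤ u := by
      rcases (D ∩ Icc (M + α - e) (M + α + e)).eq_empty_or_nonempty with h | h
      · refine ⟨M + α, by linarith, le_rfl, by simp, fun u hu h1 h2 => ?_⟩
        have : u ∈ D ∩ Icc (M + α - e) (M + α + e) := ⟨hu, h1, h2⟩
        rw [h] at this
        exact this.elim
      · obtain ⟨t, ⟨ht, ht'⟩, hmin⟩ :=
          (isCompact_Icc.inter_left hD).exists_isLeast h
        refine ⟨t - e, by linarith [ht'.1], by linarith [ht'.2], fun v hv => ?_,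
          fun u hu h1 h2 => ?_⟩
        · exact hT t ht ⟨⟨hv.1, by linarith [ht'.1, hv.2]⟩, by linarith [hv.1, ht'.1], hv.2.le⟩
        · linarith [hmin ⟨hu, h1, h2⟩]
    have hG : {τ | τ ∈ Icc (M - e) (M + e) ∧ ∃ u ∈ D, τ ≤ u ∧ u ≤ τ + α} ⊆
        Icc (M - e) (a - e) ∪ Icc (b + e - α) (M + e) := by
      rintro τ ⟨hτ, u, hu, h1, h2⟩
      by_cases h3 : u ≤ M + e
      · left
        exact ⟨hτ.1, h1.trans (ha u hu (by linarith [hτ.1]) h3)⟩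
      · right
        rw [not_le] at h3
        have h4 := hmid u hu h3.le
        have h5 := hb u hu h4.le (by linarith [hτ.2])
        exact ⟨by linarith, hτ.2⟩
    have hGv : volume {τ | τ ∈ Icc (M - e) (M + e) ∧ ∃ u ∈ D, τ ≤ u ∧ u ≤ τ + α} ≤
        ENNReal.ofReal ((a - M) + (M + α - b)) := by
      refine (measure_mono hG).trans ((measure_union_le _ _).trans ?_)
      rw [Real.volume_Icc, Real.volume_Icc, ← ENNReal.ofReal_add (by linarith) (by linarith)]
      exact ENNReal.ofReal_le_ofReal (by linarith)
    -- If the two neighbourhoods overlap they cover (M, M + α), whose length α is at least 2e.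
    by_cases hab : a ≤ b
    · refine hGv.trans ?_
      calc ENNReal.ofReal ((a - M) + (M + α - b))
          = volume (Ioo M a ∪ Ioo b (M + α)) := by
            rw [measure_union _ measurableSet_Ioo, Real.volume_Ioo, Real.volume_Ioo,
              ENNReal.ofReal_add (by linarith) (by linarith)]
            exact Set.disjoint_left.2 fun v hv hv' => by linarith [hv.2, hv'.1]
        _ ≤ volume T := measure_mono (union_subset haT hbT)
    · rw [not_le] at hab
      calc _ ≤ volume (Icc (M - e) (M + e)) := measure_mono fun τ hτ => hτ.1
        _ ≤ volume (Ioo M (M + α)) := by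
          rw [Real.volume_Icc, Real.volume_Ioo]
          exact ENNReal.ofReal_le_ofReal (by linarith)
        _ ≤ volume T := by
          refine measure_mono fun v hv => ?_
          by_cases hva : v < a
          · exact haT ⟨hv.1, hva⟩
          · exact hbT ⟨by linarith, hv.2⟩

/-- The total amount of attacks, in the sense of the `E`-attack strategy, that a path intercepts. -/
lemma LeafCondition.intercepted_le (hQ : Q.LeafCondition α) (hα : 0 < α) (S : Q.Patrol) {M : ℝ}
    (hM : ∀ i, Q.extremityLength α i ≤ M) (hM0 : 0 ≤ M) :
    Q.length ((Q.extremitySet α)ᶜ ∩ {x | Q.Intercepts α S (x, M.toNNReal)}) +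
    ∑ i, volume (Icc (M - Q.extremityLength α i) (M + Q.extremityLength α i) ∩
      {t | Q.Intercepts α S (Q.leaf i, t.toNNReal)}) ≤ ENNReal.ofReal α := by
  -- The patrol is extended to negative times by its initial position.
  set f : ℝ → Q.Point := fun u => S.1 u.toNNReal with hf
  have hfl : LipschitzWith 1 f := by
    refine LipschitzWith.of_dist_le_mul fun u v => (S.2.dist_le_mul _ _).trans ?_
    gcongr
    rw [NNReal.dist_eq, Real.dist_eq, Real.coe_toNNReal', Real.coe_toNNReal']
    exact abs_max_sub_max_le_abs u v 0
  set T : Fin n → Set ℝ := fun i => Icc M (M + α) ∩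
    {u | dist (f u) (Q.leaf i) < Q.extremityLength α i} with hT
  have hTm : ∀ i, MeasurableSet (T i) := fun i =>
    measurableSet_Icc.inter (measurableSet_lt
      ((Q.continuous_dist_leaf i).comp hfl.continuous).measurable measurable_const)
  have hdisj : Pairwise (Function.onFun Disjoint T) := by
    intro i j hij
    refine Set.disjoint_left.2 fun u hu hu' => ?_
    have := Q.len_add_len_le_dist_leaf hij (f u)
    linarith [mem_ofPred.1 hu.2, mem_ofPred.1 hu'.2, Q.extremityLength_le_len (α := α) i,
      Q.extremityLength_le_len (α := α) j]
  have hN : Q.length ((Q.extremitySet α)ᶜ ∩ {x | Q.Intercepts α S (x, M.toNNReal)}) ≤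
      volume (Icc M (M + α) \ ⋃ i, T i) := by
    refine length_le_volume_of_lipschitz hfl
      (measurableSet_Icc.diff (MeasurableSet.iUnion hTm))
      (hQ.isOpen_extremitySet.measurableSet.compl.inter
        ((measurable_id.prodMk measurable_const) (measurableSet_setOf_intercepts hα S))) ?_
    rintro x ⟨hx, t, h1, h2, h3⟩
    have h1' : M ≤ t := by
      have : ((M.toNNReal : ℝ≥0) : ℝ) ≤ t := h1
      rwa [Real.coe_toNNReal M hM0] at this
    simp only [Real.coe_toNNReal M hM0] at h2
    have hft : f t = x := by
      simp only [hf, Real.toNNReal_coe]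
      exact h3
    -- Leaves are not regular and so belong to Eᶜ, yet they are visited during the times `T i`; they
    -- are handled as a null set.
    by_cases hleaf : ∃ i, x = Q.leaf i
    · exact Or.inl hleaf
    refine Or.inr ⟨t, ⟨⟨h1', h2⟩, fun hmem => ?_⟩, hft⟩
    obtain ⟨i, -, hi⟩ := mem_iUnion.1 hmem
    rw [mem_ofPred_eq, hft] at hi
    exact hx (hQ.mem_extremitySet_iff.2
      ⟨i, dist_pos.2 fun h => hleaf ⟨i, h⟩, hi⟩)
  have hG : ∀ i, volume (Icc (M - Q.extremityLength α i) (M + Q.extremityLength α i) ∩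
      {t | Q.Intercepts α S (Q.leaf i, t.toNNReal)}) ≤ volume (T i) := by
    intro i
    refine le_trans (measure_mono ?_) (volume_intercepted_le (α := α) (D := f ⁻¹' {Q.leaf i}) (M := M)
      (isClosed_singleton.preimage hfl.continuous) (Q.extremityLength_pos hα i)
      (by linarith [Q.extremityLength_le_half (α := α) i]) ?_)
    · rintro τ ⟨hτ, t, h1, h2, h3⟩
      have hτ0 : 0 ≤ τ := by linarith [hτ.1, hM i]
      refine ⟨hτ, t, ?_, ?_, ?_⟩
      · simp only [hf, mem_preimage, Real.toNNReal_coe]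
        exact h3
      · have : ((τ.toNNReal : ℝ≥0) : ℝ) ≤ t := h1
        rwa [Real.coe_toNNReal τ hτ0] at this
      · simpa only [Real.coe_toNNReal τ hτ0] using h2
    · rintro u hu v ⟨hv, hv'⟩
      refine ⟨hv', ?_⟩
      have h1 := hfl.dist_le_mul v u
      rw [mem_preimage, mem_singleton_iff] at hu
      rw [hu, NNReal.coe_one, one_mul, Real.dist_eq] at h1
      exact h1.trans_lt (abs_lt.2 ⟨by linarith [hv.1], by linarith [hv.2]⟩)
  calc _ ≤ volume (Icc M (M + α) \ ⋃ i, T i) + ∑ i, volume (T i) :=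
        add_le_add hN (Finset.sum_le_sum fun i _ => hG i)
    _ = volume (Icc M (M + α) \ ⋃ i, T i) + volume (⋃ i, T i) := by
        rw [measure_iUnion hdisj hTm, tsum_fintype]
    _ = volume (Icc M (M + α)) := by
        rw [add_comm]
        have h := measure_inter_add_sdiff (μ := volume) (Icc M (M + α)) (MeasurableSet.iUnion hTm)
        rwa [inter_eq_right.2 (iUnion_subset fun i => inter_subset_left)] at h
    _ = ENNReal.ofReal α := by
        rw [Real.volume_Icc]; congr 1; ring

/-! ### The attack strategy -/

/-- The normalization of the conditional measure cancels against the weight m(B). Only an inequality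
is claimed, so null sets B, for which the conditional measure vanishes, need no separate treatment.
-/
lemma cond_map_apply_le {X Y : Type*} [MeasurableSpace X] [MeasurableSpace Y] {m : Measure X}
    {B : Set X} (hB : MeasurableSet B) (hfin : m B ≠ ∞) {g : X → Y} (hg : Measurable g)
    {A : Set Y} (hA : MeasurableSet A) {w : ℝ} (hw : 0 < w) :
    (ENNReal.ofReal (m.real B / w) • (ProbabilityTheory.cond m B).map g) A ≤
      m (B ∩ g ⁻¹' A) / ENNReal.ofReal w := by
  rw [Measure.smul_apply, smul_eq_mul, Measure.map_apply hg hA,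
    ProbabilityTheory.cond_apply hB, ENNReal.ofReal_div_of_pos hw, measureReal_def,
    ENNReal.ofReal_toReal hfin, div_eq_mul_inv, div_eq_mul_inv, ← mul_assoc,
    mul_right_comm (m B), mul_right_comm (m B * (m B)⁻¹), mul_assoc]
  exact mul_le_of_le_one_left' (ENNReal.mul_inv_le_one _)

lemma cond_map_univ {X Y : Type*} [MeasurableSpace X] [MeasurableSpace Y] {m : Measure X}
    {B : Set X} (hB : MeasurableSet B) (hfin : m B ≠ ∞) {g : X → Y} (hg : Measurable g)
    {w : ℝ} (hw : 0 < w) :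
    (ENNReal.ofReal (m.real B / w) • (ProbabilityTheory.cond m B).map g) univ =
      m B / ENNReal.ofReal w := by
  rw [Measure.smul_apply, smul_eq_mul, Measure.map_apply hg MeasurableSet.univ,
    ProbabilityTheory.cond_apply hB, ENNReal.ofReal_div_of_pos hw, measureReal_def,
    ENNReal.ofReal_toReal hfin, preimage_univ, inter_univ]
  rcases eq_or_ne (m B) 0 with h0 | h0
  · simp [h0]
  · rw [ENNReal.inv_mul_cancel h0 hfin, mul_one]

lemma volume_real_Icc_sub_add (M : ℝ) {e : ℝ} (he : 0 ≤ e) :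
    (volume : Measure ℝ).real (Icc (M - e) (M + e)) = 2 * e := by
  rw [Real.volume_real_Icc_of_le (by linarith)]
  ring

/-- The `E`-attack strategy, with the lengths of the components made explicit. -/
lemma LeafCondition.eAttack_eq (hQ : Q.LeafCondition α) (hα : 0 < α) :
    Q.eAttack α =
      ENNReal.ofReal (Q.length.real (Q.extremitySet α)ᶜ /
        (Q.totalLength + Q.length.real (Q.extremitySet α))) •
      (ProbabilityTheory.cond Q.length (Q.extremitySet α)ᶜ).map
        (fun x => ((x, (Q.maxComponentLength α).toNNReal) : Q.Attack)) +
      ∑ i, ENNReal.ofReal ((volume : Measure ℝ).real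
          (Icc (Q.maxComponentLength α - Q.extremityLength α i)
            (Q.maxComponentLength α + Q.extremityLength α i)) /
          (Q.totalLength + Q.length.real (Q.extremitySet α))) •
        (ProbabilityTheory.cond (volume : Measure ℝ)
          (Icc (Q.maxComponentLength α - Q.extremityLength α i)
            (Q.maxComponentLength α + Q.extremityLength α i))).map
          (fun t => ((Q.leaf i, t.toNNReal) : Q.Attack)) := by
  rw [eAttack]
  congr 1
  refine Finset.sum_congr rfl fun i _ => ?_
  rw [hQ.leafComponentLength_eq hα, volume_real_Icc_sub_add _ (Q.extremityLength_pos hα i).le]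

lemma measurable_attack_point (τ : ℝ≥0) :
    Measurable fun x : Q.Point => ((x, τ) : Q.Attack) :=
  measurable_id.prodMk measurable_const

lemma measurable_attack_time (x : Q.Point) :
    Measurable fun t : ℝ => ((x, t.toNNReal) : Q.Attack) :=
  measurable_const.prodMk measurable_real_toNNReal

lemma extremityLength_le_maxComponentLength (hQ : Q.LeafCondition α) (hα : 0 < α) (i : Fin n) :
    Q.extremityLength α i ≤ Q.maxComponentLength α := by
  rw [← hQ.leafComponentLength_eq hα]
  exact le_ciSup (f := Q.leafComponentLength α) (Set.finite_range _).bddAbove i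

lemma LeafCondition.isProbabilityMeasure_eAttack (hQ : Q.LeafCondition α) (hα : 0 < α)
    (hn : 0 < n) : IsProbabilityMeasure (Q.eAttack α) := by
  have hw : 0 < Q.totalLength + Q.length.real (Q.extremitySet α) :=
    add_pos_of_pos_of_nonneg (Q.totalLength_pos hn) measureReal_nonneg
  refine ⟨?_⟩
  rw [hQ.eAttack_eq hα, Measure.add_apply, Measure.finsetSum_apply,
    cond_map_univ hQ.isOpen_extremitySet.measurableSet.compl (measure_ne_top _ _)
      (measurable_attack_point _) hw,
    Finset.sum_congr rfl fun i _ => cond_map_univ measurableSet_Icc (by simp)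
      (measurable_attack_time _) hw]
  simp only [div_eq_mul_inv]
  rw [← Finset.sum_mul, ← add_mul]
  -- The weights add up: λ(Eᶜ) + 2λ(E) = μ + λ(E).
  have : Q.length (Q.extremitySet α)ᶜ + ∑ i, volume
      (Icc (Q.maxComponentLength α - Q.extremityLength α i)
        (Q.maxComponentLength α + Q.extremityLength α i)) =
      ENNReal.ofReal (Q.totalLength + Q.length.real (Q.extremitySet α)) := by
    simp only [Real.volume_Icc]
    rw [← ENNReal.ofReal_sum_of_nonneg fun i _ => by linarith [Q.extremityLength_pos hα i],
      ← ENNReal.ofReal_toReal (measure_ne_top Q.length (Q.extremitySet α)ᶜ),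
      ← ENNReal.ofReal_add ENNReal.toReal_nonneg (Finset.sum_nonneg fun i _ => by
        linarith [Q.extremityLength_pos hα i])]
    congr 1
    have h1 : Q.length.real (Q.extremitySet α) + Q.length.real (Q.extremitySet α)ᶜ =
        Q.totalLength := by
      rw [measureReal_add_measureReal_compl hQ.isOpen_extremitySet.measurableSet,
        measureReal_def, length_univ, ENNReal.toReal_ofReal (Q.totalLength_pos hn).le]
    have h2 := hQ.length_extremitySet hα
    rw [measureReal_def] at h1 h2
    have h3 : ∑ i, (Q.maxComponentLength α + Q.extremityLength α i -
        (Q.maxComponentLength α - Q.extremityLength α i)) = 2 * ∑ i, Q.extremityLength α i := by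
      rw [Finset.mul_sum]
      exact Finset.sum_congr rfl fun i _ => by ring
    rw [h3, ← h2, measureReal_def]
    rw [measureReal_def] at h1
    linarith
  rw [this]
  exact ENNReal.mul_inv_cancel (by simpa using hw) ENNReal.ofReal_ne_top

/-- Against the `E`-attack strategy no patrol intercepts with a higher probability than the
claimed value. -/
lemma LeafCondition.eAttack_intercepts_le (hQ : Q.LeafCondition α) (hα : 0 < α)
    (hn : 0 < n) (S : Q.Patrol) : Q.eAttack α {a | Q.Intercepts α S a} ≤
      ENNReal.ofReal (α / (Q.totalLength + Q.length.real (Q.extremitySet α))) := by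
  have hw : 0 < Q.totalLength + Q.length.real (Q.extremitySet α) :=
    add_pos_of_pos_of_nonneg (Q.totalLength_pos hn) measureReal_nonneg
  have hA := measurableSet_setOf_intercepts hα S
  have hM := extremityLength_le_maxComponentLength hQ hα
  rw [hQ.eAttack_eq hα, Measure.add_apply, Measure.finsetSum_apply]
  refine (add_le_add (cond_map_apply_le hQ.isOpen_extremitySet.measurableSet.compl
    (measure_ne_top _ _) (measurable_attack_point _) hA hw)
    (Finset.sum_le_sum fun i _ => cond_map_apply_le measurableSet_Icc (by simp)
      (measurable_attack_time _) hA hw)).trans ?_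
  simp only [div_eq_mul_inv]
  rw [← Finset.sum_mul, ← add_mul, ← div_eq_mul_inv α, ENNReal.ofReal_div_of_pos hw,
    div_eq_mul_inv]
  gcongr
  exact hQ.intercepted_le hα S hM
    ((Q.extremityLength_pos hα ⟨0, hn⟩).le.trans (hM ⟨0, hn⟩))

lemma totalLength_nonneg (Q : StarNetwork n) : 0 ≤ Q.totalLength :=
  Finset.sum_nonneg fun i _ => (Q.len_pos i).le

/-! ### Tours with prescribed times of visits to the leaves -/

/-- On a circle of length L, being a apart means being a apart in both directions around. -/
lemma le_norm_addCircle {L a x : ℝ} (ha : a ≤ |x|) (hx : |x| ≤ L - a) (hL : 0 ≤ L) :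
    a ≤ ‖(x : AddCircle L)‖ := by
  rw [AddCircle.norm_eq]
  rcases eq_or_ne (round (L⁻¹ * x)) 0 with h | h
  · rwa [h, Int.cast_zero, zero_mul, sub_zero]
  · have h1 : (1 : ℝ) ≤ |(round (L⁻¹ * x) : ℝ)| := by
      exact_mod_cast Int.one_le_abs h
    have h2 : L ≤ |(round (L⁻¹ * x) : ℝ) * L| := by
      rw [abs_mul, abs_of_nonneg hL]
      exact le_mul_of_one_le_left hL h1
    have h3 := abs_sub_abs_le_abs_sub ((round (L⁻¹ * x) : ℝ) * L) x
    rw [abs_sub_comm] at h3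
    linarith

lemma norm_addCircle_le_abs (L x : ℝ) : ‖(x : AddCircle L)‖ ≤ |x| :=
  QuotientAddGroup.norm_mk_le_norm

variable (Q) in
/-- The distance on the circle of length `2 μ` between `t` and the time `m i`. -/
def circleDist (m : Fin n → ℝ) (i : Fin n) (t : ℝ) : ℝ :=
  ‖((t - m i : ℝ) : AddCircle (2 * Q.totalLength))‖

lemma circleDist_le_add (m : Fin n → ℝ) (i : Fin n) (t u : ℝ) :
    Q.circleDist m i t ≤ Q.circleDist m i u + |t - u| := by
  have h : (t - m i : ℝ) = (u - m i) + (t - u) := by ring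
  rw [circleDist, circleDist, h, AddCircle.coe_add]
  exact (norm_add_le _ _).trans (add_le_add_right (norm_addCircle_le_abs _ _) _)

variable (Q) in
/-- The times `m i` are far enough apart for visits of the leaves on one tour of length `2 μ`. -/
def IsSeparated (m : Fin n → ℝ) : Prop :=
  ∀ i j, i ≠ j → Q.len i + Q.len j ≤ ‖((m i - m j : ℝ) : AddCircle (2 * Q.totalLength))‖

/-- With t = u this makes the arcs of time around the visits non-overlapping, so `tourPoint` is well
defined; with t ≠ u it is the Lipschitz bound between two different arcs. -/
lemma IsSeparated.len_add_len_le {m : Fin n → ℝ} (hm : Q.IsSeparated m) {i j : Fin n}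
    (hij : i ≠ j) (t u : ℝ) :
    Q.len i + Q.len j ≤ Q.circleDist m i t + Q.circleDist m j u + |t - u| := by
  refine (hm i j hij).trans ?_
  have h : (m i - m j : ℝ) = (u - m j) - (t - m i) + (t - u) := by ring
  rw [h, AddCircle.coe_add, AddCircle.coe_sub]
  refine (norm_add_le _ _).trans (add_le_add ?_ (norm_addCircle_le_abs _ _))
  refine (norm_sub_le _ _).trans ?_
  rw [add_comm]
  rfl

open Classical in
variable (Q) in
/-- The point at time `t` of the tour that visits leaf `i` at time `m i`. -/
def tourPoint (hn : 0 < n) (m : Fin n → ℝ) (t : ℝ) : Q.Point :=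
  if h : ∃ i, Q.circleDist m i t < Q.len i then
    Q.arc h.choose (Q.len h.choose - Q.circleDist m h.choose t) else Q.arc ⟨0, hn⟩ 0

lemma IsSeparated.tourPoint_eq (hn : 0 < n) {m : Fin n → ℝ} (hm : Q.IsSeparated m) {i : Fin n}
    {t : ℝ} (h : Q.circleDist m i t ≤ Q.len i) :
    Q.tourPoint hn m t = Q.arc i (Q.len i - Q.circleDist m i t) := by
  rw [tourPoint]
  split_ifs with hex
  · by_cases hij : hex.choose = i
    · rw [hij]
    · have h1 := hm.len_add_len_le hij t t
      rw [sub_self, abs_zero, add_zero] at h1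
      linarith [hex.choose_spec]
  · push Not at hex
    rw [le_antisymm h (hex i), sub_self]
    exact Q.arc_zero _ _

lemma tourPoint_eq_center (hn : 0 < n) {m : Fin n → ℝ} {t : ℝ}
    (h : ∀ i, Q.len i ≤ Q.circleDist m i t) : Q.tourPoint hn m t = Q.arc ⟨0, hn⟩ 0 := by
  rw [tourPoint, dif_neg]
  push Not
  exact h

lemma circleDist_nonneg (m : Fin n → ℝ) (i : Fin n) (t : ℝ) : 0 ≤ Q.circleDist m i t :=
  norm_nonneg _

lemma IsSeparated.dist_tourPoint_le (hn : 0 < n) {m : Fin n → ℝ} (hm : Q.IsSeparated m)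
    (t u : ℝ) : dist (Q.tourPoint hn m t) (Q.tourPoint hn m u) ≤ |t - u| := by
  have key : ∀ t u i, Q.circleDist m i t ≤ Q.len i →
      dist (Q.tourPoint hn m t) (Q.tourPoint hn m u) ≤ |t - u| := by
    intro t u i hi
    have hi0 := circleDist_nonneg (Q := Q) m i t
    rw [hm.tourPoint_eq hn hi]
    by_cases hu : ∃ j, Q.circleDist m j u ≤ Q.len j
    · obtain ⟨j, hj⟩ := hu
      have hj0 := circleDist_nonneg (Q := Q) m j u
      rw [hm.tourPoint_eq hn hj]
      by_cases hij : i = j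
      · subst hij
        rw [dist_arc_same Q (by linarith) (by linarith) (by linarith) (by linarith), abs_le]
        have h1 := circleDist_le_add (Q := Q) m i t u
        have h2 := circleDist_le_add (Q := Q) m i u t
        rw [abs_sub_comm] at h2
        constructor <;> linarith
      · rw [dist_arc_ne Q hij (by linarith) (by linarith) (by linarith) (by linarith)]
        linarith [hm.len_add_len_le hij t u]
    · push Not at hu
      rw [tourPoint_eq_center hn fun j => (hu j).le, Q.arc_zero _ i,
        dist_arc_same Q (by linarith) (by linarith) le_rfl (Q.len_pos i).le, sub_zero,
        abs_of_nonneg (by linarith)]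
      have h2 := circleDist_le_add (Q := Q) m i u t
      rw [abs_sub_comm] at h2
      linarith [hu i]
  by_cases ht : ∃ i, Q.circleDist m i t ≤ Q.len i
  · obtain ⟨i, hi⟩ := ht
    exact key t u i hi
  by_cases hu : ∃ i, Q.circleDist m i u ≤ Q.len i
  · obtain ⟨i, hi⟩ := hu
    rw [dist_comm, abs_sub_comm]
    exact key u t i hi
  push Not at ht hu
  rw [tourPoint_eq_center hn fun j => (hu j).le, tourPoint_eq_center hn fun j => (ht j).le,
    dist_self]
  exact abs_nonneg _

/-- The closed path of length `2 μ` that visits leaf `i` at time `m i`. -/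
def IsSeparated.tour (hn : 0 < n) {m : Fin n → ℝ} (hm : Q.IsSeparated m) : Q.ClosedPath where
  toFun := Q.tourPoint hn m
  period := 2 * Q.totalLength
  period_pos := by linarith [Q.totalLength_pos hn]
  lipschitz := LipschitzWith.of_dist_le_mul fun t u => by
    simpa [Real.dist_eq] using hm.dist_tourPoint_le hn t u
  periodic := fun t => by
    have : ∀ i, Q.circleDist m i (t + 2 * Q.totalLength) = Q.circleDist m i t := fun i => by
      rw [circleDist, circleDist, add_sub_right_comm, AddCircle.coe_add_period]
    simp only [tourPoint, this]

lemma circleDist_eq_abs (hn : 0 < n) (m : Fin n → ℝ) (i : Fin n) {t : ℝ}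
    (h : |t - m i| ≤ Q.totalLength) : Q.circleDist m i t = |t - m i| := by
  have hμ := Q.totalLength_pos hn
  rw [circleDist, AddCircle.norm_coe_eq_abs_iff _ (by positivity),
    abs_of_pos (by positivity : 0 < 2 * Q.totalLength)]
  linarith

lemma IsSeparated.tour_apply (hn : 0 < n) {m : Fin n → ℝ} (hm : Q.IsSeparated m) (i : Fin n)
    {t : ℝ} (h : |t - m i| ≤ Q.len i) :
    (hm.tour hn).toFun t = Q.arc i (Q.len i - |t - m i|) := by
  have h1 := circleDist_eq_abs hn m i (h.trans (Q.len_le_totalLength i))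
  rw [← h1] at h ⊢
  exact hm.tourPoint_eq hn h

lemma IsSeparated.isTour_tour (hn : 0 < n) {m : Fin n → ℝ} (hm : Q.IsSeparated m) :
    (hm.tour hn).IsTour := by
  intro x
  obtain ⟨i, t, h0, h1, rfl⟩ := Q.exists_eq_arc x
  have h2 : |m i + (Q.len i - t) - m i| = Q.len i - t := by
    rw [add_sub_cancel_left, abs_of_nonneg (by linarith)]
  have h3 := hm.tour_apply hn i (t := m i + (Q.len i - t)) (by rw [h2]; linarith)
  obtain ⟨u, hu, h⟩ := (hm.tour hn).periodic.exists_mem_Ico₀ (hm.tour hn).period_pos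
    (m i + (Q.len i - t))
  refine ⟨u, Ico_subset_Icc_self hu, ?_⟩
  rw [← h, h3, h2, sub_sub_cancel]

/-! ### The tour that visits the arcs in the order of their lengths -/

variable (Q) in
/-- The arcs ordered by length. -/
def arcKey (i : Fin n) : ℝ ×ₗ Fin n := toLex (Q.len i, i)

lemma arcKey_injective : Function.Injective Q.arcKey := fun i j h => by
  have := congrArg (fun x => (ofLex x).2) h
  simpa [arcKey] using this

lemma arcKey_lt_of_len_lt {i j : Fin n} (h : Q.len i < Q.len j) : Q.arcKey i < Q.arcKey j :=
  Prod.Lex.toLex_lt_toLex.2 (Or.inl h)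

lemma len_le_of_arcKey_le {i j : Fin n} (h : Q.arcKey i ≤ Q.arcKey j) : Q.len i ≤ Q.len j := by
  rcases Prod.Lex.toLex_le_toLex.1 h with h | h
  · exact h.le
  · exact h.1.le

variable (Q) in
/-- The time at which the ordered tour starts to search arc `i`. -/
def arcStart (i : Fin n) : ℝ := ∑ j with Q.arcKey j < Q.arcKey i, 2 * Q.len j

lemma sum_two_len_le {s t : Finset (Fin n)} (h : s ⊆ t) :
    ∑ j ∈ s, 2 * Q.len j ≤ ∑ j ∈ t, 2 * Q.len j :=
  Finset.sum_le_sum_of_subset_of_nonneg h fun j _ _ => by linarith [Q.len_pos j]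

lemma arcStart_nonneg (i : Fin n) : 0 ≤ Q.arcStart i :=
  Finset.sum_nonneg fun j _ => by linarith [Q.len_pos j]

lemma arcStart_add_le_sum {i : Fin n} {t : Finset (Fin n)}
    (h : ∀ j, Q.arcKey j ≤ Q.arcKey i → j ∈ t) :
    Q.arcStart i + 2 * Q.len i ≤ ∑ j ∈ t, 2 * Q.len j := by
  rw [arcStart, add_comm, ← Finset.sum_insert (f := fun j => 2 * Q.len j) (by simp)]
  refine sum_two_len_le fun j hj => h j ?_
  rcases Finset.mem_insert.1 hj with rfl | hj
  · exact le_rfl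
  · exact (Finset.mem_filter.1 hj).2.le

lemma sum_two_len_univ : ∑ j, 2 * Q.len j = 2 * Q.totalLength := by
  rw [← Finset.mul_sum, totalLength]

lemma arcStart_add_le (i : Fin n) : Q.arcStart i + 2 * Q.len i ≤ 2 * Q.totalLength := by
  rw [← sum_two_len_univ]
  exact arcStart_add_le_sum fun j _ => Finset.mem_univ j

lemma arcStart_add_le_arcStart {i j : Fin n} (h : Q.arcKey i < Q.arcKey j) :
    Q.arcStart i + 2 * Q.len i ≤ Q.arcStart j :=
  arcStart_add_le_sum fun k hk => by simpa using hk.trans_lt h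

variable (Q) in
/-- The times of visits to the leaves on the ordered tour that starts from the center at time
`p`. -/
def orderedVisit (p : ℝ) (i : Fin n) : ℝ := p + Q.arcStart i + Q.len i

/-- The searches are consecutive blocks of lengths 2ℓ_i filling one period, with visits at the block
centers. Going either way around the circle from one visit to another crosses half of both blocks.
-/
lemma isSeparated_orderedVisit (p : ℝ) : Q.IsSeparated (Q.orderedVisit p) := by
  have key : ∀ i j, Q.arcKey i < Q.arcKey j → Q.len i + Q.len j ≤
      ‖((Q.orderedVisit p j - Q.orderedVisit p i : ℝ) : AddCircle (2 * Q.totalLength))‖ := by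
    intro i j h
    have h1 := arcStart_add_le_arcStart h
    have h2 := arcStart_add_le j (Q := Q)
    have h3 := arcStart_nonneg i (Q := Q)
    have hi := Q.len_pos i
    have hj := Q.len_pos j
    have h4 : |Q.orderedVisit p j - Q.orderedVisit p i| =
        Q.arcStart j + Q.len j - (Q.arcStart i + Q.len i) := by
      rw [abs_of_nonneg] <;> simp only [orderedVisit] <;> linarith
    apply le_norm_addCircle <;> linarith [Q.totalLength_nonneg]
  intro i j hij
  rcases lt_or_gt_of_ne (arcKey_injective.ne hij) with h | h
  · rw [← norm_neg, ← AddCircle.coe_neg, neg_sub]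
    exact key i j h
  · rw [add_comm]
    exact key j i h

/-- Chinese Postman Tours of a star are the tours of length `2 μ`. -/
lemma ClosedPath.isCPT_iff (hn : 0 < n) {S : Q.ClosedPath} :
    S.IsCPT ↔ S.IsTour ∧ S.period = 2 * Q.totalLength := by
  have hsep := isSeparated_orderedVisit (Q := Q) 0
  constructor
  · rintro ⟨h1, h2⟩
    exact ⟨h1, le_antisymm (h2 _ (hsep.isTour_tour hn)) (h1.two_mul_totalLength_le hn)⟩
  · rintro ⟨h1, h2⟩
    exact ⟨h1, fun S' hS' => h2 ▸ hS'.two_mul_totalLength_le hn⟩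

/-! ### Randomized closed paths -/

lemma ClosedPath.measurable_shift (P : Q.ClosedPath) : Measurable P.shift :=
  (measurable_pi_lambda _ fun _ =>
    (P.continuous.comp (continuous_const.add continuous_id)).measurable).subtype_mk

instance (P : Q.ClosedPath) : IsProbabilityMeasure P.randomized := by
  have : IsProbabilityMeasure (ProbabilityTheory.cond (volume : Measure ℝ) (Icc 0 P.period)) :=
    ProbabilityTheory.cond_isProbabilityMeasure_of_finite
      (by simpa using P.period_pos) (by simp)
  exact Measure.isProbabilityMeasure_map P.measurable_shift.aemeasurable

lemma ClosedPath.intercepts_shift (P : Q.ClosedPath) {a : Q.Attack} {u Δ : ℝ}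
    (hu : P.toFun u = a.1) (h : Δ ∈ Ioc (u - a.2 - α) (u - a.2)) :
    Q.Intercepts α (P.shift Δ) a := by
  have h0 : 0 ≤ u - Δ := by linarith [h.2, a.2.coe_nonneg]
  refine ⟨(u - Δ).toNNReal, ?_, ?_, ?_⟩
  · rw [← NNReal.coe_le_coe, Real.coe_toNNReal _ h0]
    linarith [h.2]
  · rw [Real.coe_toNNReal _ h0]
    linarith [h.1]
  · show P.toFun ((u - Δ).toNNReal + Δ) = a.1
    rw [Real.coe_toNNReal _ h0, sub_add_cancel, hu]

/-- The interception probability is at least the relative measure of any set of interception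
shifts within one period. -/
lemma ClosedPath.le_randomized (hα : 0 < α) (P : Q.ClosedPath) (a : Q.Attack) (b : ℝ)
    {B : Set ℝ} (hB : B ⊆ Ioc b (b + P.period))
    (hint : ∀ Δ ∈ B, Q.Intercepts α (P.shift Δ) a) :
    volume B / ENNReal.ofReal P.period ≤ P.randomized {S | Q.Intercepts α S a} := by
  have hm : MeasurableSet {S | Q.Intercepts α S a} :=
    measurable_prodMk_right (y := a) (measurableSet_intercepts hα)
  set A : Set ℝ := P.shift ⁻¹' {S | Q.Intercepts α S a} with hA
  have hAm : MeasurableSet A := P.measurable_shift hm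
  -- The set of intercepting shifts is periodic, so its measure may be computed in any window of one
  -- period rather than in [0, L].
  have hper : ∀ g : AddSubgroup.zmultiples P.period, (fun x => g +ᵥ x) ⁻¹' A = A := by
    rintro ⟨g, k, rfl⟩
    ext Δ
    have : P.shift ((k • P.period) + Δ) = P.shift Δ := by
      apply Subtype.ext
      funext t
      show P.toFun (t + (k • P.period + Δ)) = P.toFun (t + Δ)
      rw [← P.periodic.zsmul k (t + Δ)]
      congr 1
      ring
    show Q.Intercepts α (P.shift (k • P.period + Δ)) a ↔ Q.Intercepts α (P.shift Δ) a
    rw [this]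
  have hvol := (isAddFundamentalDomain_Ioc P.period_pos b).measure_set_eq
    (isAddFundamentalDomain_Ioc P.period_pos 0) hAm hper
  rw [randomized, Measure.map_apply P.measurable_shift hm,
    ProbabilityTheory.cond_apply measurableSet_Icc, Real.volume_Icc, sub_zero, div_eq_mul_inv,
    mul_comm]
  refine mul_le_mul_right ?_ _
  calc volume B ≤ volume (A ∩ Ioc b (b + P.period)) :=
        measure_mono fun Δ hΔ => ⟨hint Δ hΔ, hB hΔ⟩
    _ = volume (A ∩ Ioc 0 (0 + P.period)) := hvol
    _ ≤ volume (Icc 0 P.period ∩ A) := by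
        refine measure_mono fun Δ hΔ => ⟨⟨hΔ.2.1.le, by simpa using hΔ.2.2⟩, hΔ.1⟩

/-- A tour intercepts every attack with probability at least `α / L`. -/
lemma ClosedPath.IsTour.le_randomized (hα : 0 < α) {P : Q.ClosedPath} (hP : P.IsTour)
    (hL : α ≤ P.period) (a : Q.Attack) :
    ENNReal.ofReal (α / P.period) ≤ P.randomized {S | Q.Intercepts α S a} := by
  obtain ⟨u, -, hu⟩ := hP a.1
  refine le_trans (le_of_eq ?_) (P.le_randomized hα a (u - a.2 - α)
    (B := Ioc (u - a.2 - α) (u - a.2)) ?_ fun Δ hΔ => P.intercepts_shift hu hΔ)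
  · rw [Real.volume_Ioc, sub_sub_cancel, ENNReal.ofReal_div_of_pos P.period_pos]
  · exact Ioc_subset_Ioc_right (by linarith)

/-- A point visited at two times that are, on the circle of length `L`, at least `α` apart. -/
def ClosedPath.VisitsTwice (α : ℝ) (P : Q.ClosedPath) (x : Q.Point) : Prop :=
  ∃ t u, P.toFun t = x ∧ P.toFun u = x ∧ t + α ≤ u ∧ u + α ≤ t + P.period

/-- Attacks at a point that is visited twice are intercepted with probability at least
`2 α / L`. -/
lemma ClosedPath.VisitsTwice.le_randomized (hα : 0 < α) {P : Q.ClosedPath} {a : Q.Attack}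
    (h : P.VisitsTwice α a.1) :
    ENNReal.ofReal (2 * α / P.period) ≤ P.randomized {S | Q.Intercepts α S a} := by
  obtain ⟨t, u, ht, hu, h1, h2⟩ := h
  refine le_trans (le_of_eq ?_) (P.le_randomized hα a (t - a.2 - α)
    (B := Ioc (t - a.2 - α) (t - a.2) ∪ Ioc (u - a.2 - α) (u - a.2)) ?_ ?_)
  · rw [measure_union _ measurableSet_Ioc, Real.volume_Ioc, Real.volume_Ioc, sub_sub_cancel,
      sub_sub_cancel, ENNReal.ofReal_div_of_pos P.period_pos, two_mul,
      ENNReal.ofReal_add hα.le hα.le]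
    exact Set.disjoint_left.2 fun v hv hv' => by linarith [hv.2, hv'.1]
  · exact union_subset (Ioc_subset_Ioc_right (by linarith))
      (Ioc_subset_Ioc (by linarith) (by linarith))
  · rintro Δ (hΔ | hΔ)
    · exact P.intercepts_shift ht hΔ
    · exact P.intercepts_shift hu hΔ

/-! ### Visits on a tour -/

/-- The distance from a leaf takes intermediate values along a path. -/
lemma ClosedPath.exists_dist_leaf_eq (P : Q.ClosedPath) (i : Fin n) {c a b : ℝ}
    (ha : dist (P.toFun a) (Q.leaf i) ≤ c) (hb : c ≤ dist (P.toFun b) (Q.leaf i)) :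
    ∃ w ∈ uIcc a b, dist (P.toFun w) (Q.leaf i) = c := by
  have hc : ContinuousOn (fun t => dist (P.toFun t) (Q.leaf i)) (uIcc a b) :=
    ((Q.continuous_dist_leaf i).comp P.continuous).continuousOn
  exact (isPreconnected_uIcc.intermediate_value left_mem_uIcc right_mem_uIcc hc) ⟨ha, hb⟩

lemma ClosedPath.dist_le_of_le (P : Q.ClosedPath) {a b : ℝ} (hab : a ≤ b) {x y : Q.Point}
    (ha : P.toFun a = x) (hb : P.toFun b = y) : dist x y ≤ b - a := by
  have := P.dist_le a b
  rwa [ha, hb, abs_sub_comm, abs_of_nonneg (by linarith)] at this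

/-- On a balanced star every tour visits the points outside the open extremity set twice. -/
lemma ClosedPath.IsTour.visitsTwice {P : Q.ClosedPath} (hP : P.IsTour) {i : Fin n}
    (hbal : Q.len i ≤ Q.totalLength / 2) {p : ℝ} (hp0 : 0 ≤ p) (hp : p ≤ Q.len i - α / 2)
    (hα : 0 < α) : P.VisitsTwice α (Q.arc i p) := by
  set x := Q.arc i p with hx
  have hxi : dist x (Q.leaf i) = Q.len i - p := Q.dist_arc_leaf_same hp0 (by linarith)
  have hL := P.period_pos
  obtain ⟨c, -, hc⟩ := hP (Q.leaf i)
  have hD : IsClosed {u | P.toFun u = x} := isClosed_eq P.continuous continuous_const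
  have hex : ∀ a, ({u | P.toFun u = x} ∩ Icc a (a + P.period)).Nonempty := fun a => by
    obtain ⟨t, ht, htx⟩ := hP.exists_mem_Icc x a
    exact ⟨t, htx, Ico_subset_Icc_self ht⟩
  -- `t` is the last visit to x before the visit `c` to leaf i, and `u` the first one after it. The
  -- way to the leaf and back already takes 2(ℓ_i - p) ≥ α.
  obtain ⟨t, ⟨ht, ht'⟩, htmax⟩ :=
    (isCompact_Icc.inter_left hD).exists_isGreatest (hex (c - P.period))
  obtain ⟨u, ⟨hu, hu'⟩, humin⟩ := (isCompact_Icc.inter_left hD).exists_isLeast (hex c)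
  rw [sub_add_cancel] at ht'
  have h1 : Q.len i - p ≤ c - t := by
    rw [← hxi]
    exact P.dist_le_of_le ht'.2 ht hc
  have h2 : Q.len i - p ≤ u - c := by
    rw [← hxi, dist_comm]
    exact P.dist_le_of_le hu'.1 hc hu
  have htL : P.toFun (t + P.period) = x := by rw [P.periodic]; exact ht
  have h3 : u ≤ t + P.period :=
    humin ⟨htL, by linarith [ht'.1], by linarith [ht'.2]⟩
  refine ⟨t, u, ht, hu, by linarith, ?_⟩
  choose v hv hvx using fun j => hP.exists_mem_Icc (Q.leaf j) t
  -- Reaching another leaf between t and u would require crossing x, against the choice of t and u.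
  have hout : ∀ j, j ≠ i → u ≤ v j := by
    intro j hj
    by_contra hlt
    rw [not_le] at hlt
    obtain ⟨w, hw, hwx⟩ := P.exists_dist_leaf_eq i (c := Q.len i - p) (a := c) (b := v j)
      (by rw [hc, dist_self]; linarith)
      (by rw [hvx, dist_leaf_leaf Q hj]; linarith [Q.len_pos j])
    have hwx' : P.toFun w = x := (Q.eq_arc_iff hp0 (by linarith)).2 hwx
    rcases le_total c (v j) with hcv | hcv
    · rw [uIcc_of_le hcv] at hw
      have := humin ⟨hwx', hw.1, by linarith [hw.2, hu'.2]⟩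
      linarith [hw.2]
    · rw [uIcc_of_ge hcv] at hw
      have h4 : w ≤ t := htmax ⟨hwx', by linarith [hw.1, (hv j).1, ht'.1], by linarith [hw.2]⟩
      have h5 : w = v j := by linarith [hw.1, (hv j).1]
      rw [h5, hvx, dist_leaf_leaf Q hj] at hwx
      linarith [Q.len_pos j]
  have hxj : ∀ j, j ≠ i → Q.len j ≤ dist x (Q.leaf j) := by
    intro j hj
    rw [hx, Q.dist_arc_leaf_ne hj.symm hp0 (by linarith)]
    linarith
  -- All other leaves are visited in [u, t + L], which therefore lasts at least 2μ - 2ℓ_i; by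
  -- balance this is at least 2ℓ_i ≥ α.
  have hpack := sum_two_mul_le_of_separated (Finset.univ.erase i) v Q.len (a := u)
    (b := t + P.period) h3 (fun j hj => ?_) (fun j hj => ?_) (fun j _ => (Q.len_pos j).le)
    (fun j _ k _ hjk => ?_)
  · have hsum : ∑ j ∈ Finset.univ.erase i, 2 * Q.len j = 2 * Q.totalLength - 2 * Q.len i := by
      rw [← sum_two_len_univ, ← Finset.add_sum_erase _ _ (Finset.mem_univ i)]
      ring
    linarith
  · have hj' := Finset.ne_of_mem_erase hj
    have := P.dist_le_of_le (hout j hj') hu (hvx j)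
    linarith [hxj j hj']
  · have hj' := Finset.ne_of_mem_erase hj
    have := P.dist_le_of_le (hv j).2.le (hvx j) htL
    rw [dist_comm] at this
    linarith [hxj j hj']
  · have h := P.dist_le (v j) (v k)
    rwa [hvx, hvx, dist_leaf_leaf Q hjk] at h

/-- A Chinese Postman Tour that leaves the short arcs returns to them after searching exactly one
other arc. -/
lemma ClosedPath.IsTour.excursion_eq {S : Q.ClosedPath} (hS : S.IsTour)
    (hper : S.period = 2 * Q.totalLength) {a b : ℝ} (hab : a < b) (hb : b ≤ a + S.period)
    (ha : S.toFun a ∈ Q.shortArcs α) (hb' : S.toFun b ∈ Q.shortArcs α)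
    (hout : ∀ t ∈ Ioo a b, S.toFun t ∉ Q.shortArcs α) :
    ∃ i, α / 2 < Q.len i ∧ b - a = 2 * Q.len i := by
  obtain ⟨k, hk, -⟩ := id ha
  have hcen : Q.arc k 0 ∈ Q.shortArcs α := ⟨k, hk, by rw [dist_center_leaf]⟩
  -- The points of the short arcs other than the center are interior points.
  have hbd : ∀ x ∈ Q.shortArcs α, x ≠ Q.arc k 0 → ∃ δ > 0, ∀ y, dist y x < δ →
      y ∈ Q.shortArcs α := by
    rintro x ⟨j, hj, hjx⟩ hne
    have hlt : dist x (Q.leaf j) < Q.len j := by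
      refine lt_of_le_of_ne hjx fun h => hne ?_
      rw [Q.arc_zero k j, Q.eq_arc_iff le_rfl (Q.len_pos j).le, h, sub_zero]
    refine ⟨Q.len j - dist x (Q.leaf j), by linarith, fun y hy => ⟨j, hj, ?_⟩⟩
    linarith [dist_triangle y x (Q.leaf j)]
  -- The path cannot leave the short arcs immediately from one of their interior points, so the
  -- excursion starts at the center; it ends there for the same reason.
  have haC : S.toFun a = Q.arc k 0 := by
    by_contra hne
    obtain ⟨δ, hδ, h⟩ := hbd _ ha hne
    have hm : 0 < min δ (b - a) := lt_min hδ (by linarith)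
    refine hout (a + min δ (b - a) / 2) ⟨by linarith, by linarith [min_le_right δ (b - a)]⟩
      (h _ ?_)
    refine (S.dist_le _ _).trans_lt ?_
    rw [add_sub_cancel_left, abs_of_pos (by linarith)]
    linarith [min_le_left δ (b - a)]
  have hbC : S.toFun b = Q.arc k 0 := by
    by_contra hne
    obtain ⟨δ, hδ, h⟩ := hbd _ hb' hne
    have hm : 0 < min δ (b - a) := lt_min hδ (by linarith)
    refine hout (b - min δ (b - a) / 2) ⟨by linarith [min_le_right δ (b - a)], by linarith⟩
      (h _ ?_)
    refine (S.dist_le _ _).trans_lt ?_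
    rw [sub_sub_cancel_left, abs_neg, abs_of_pos (by linarith)]
    linarith [min_le_left δ (b - a)]
  have haL : S.toFun (a + S.period) = Q.arc k 0 := by rw [S.periodic, haC]
  -- the arc searched during the excursion
  obtain ⟨i, q, hq0, hq1, hiq⟩ := Q.exists_eq_arc (S.toFun ((a + b) / 2))
  have hmid : (a + b) / 2 ∈ Ioo a b := ⟨by linarith, by linarith⟩
  have hnot := hout _ hmid
  have hqpos : 0 < q := by
    refine lt_of_le_of_ne hq0 fun h => hnot ?_
    rw [hiq, ← h, Q.arc_zero i k]
    exact hcen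
  have hi : α / 2 < Q.len i := by
    by_contra h
    refine hnot ⟨i, not_lt.1 h, ?_⟩
    rw [hiq, dist_arc_leaf_same Q hq0 hq1]
    linarith
  choose v hv hvx using fun j => hS.exists_mem_Icc (Q.leaf j) a
  -- The excursion is confined to arc i: any way to another leaf passes through the center, which
  -- belongs to the short arcs.
  have hin : ∀ j, v j < b → j = i := by
    intro j hlt
    by_contra hj
    have hva : v j ≠ a := fun h => Q.leaf_ne_center j k (by rw [← hvx, h, haC])
    obtain ⟨w, hw, hwx⟩ := S.exists_dist_leaf_eq i (c := Q.len i) (a := (a + b) / 2) (b := v j)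
      (by rw [hiq, dist_arc_leaf_same Q hq0 hq1]; linarith)
      (by rw [hvx, dist_leaf_leaf Q hj]; linarith [Q.len_pos j])
    have hwI : w ∈ Ioo a b := by
      have h1 : a < v j := lt_of_le_of_ne (hv j).1 hva.symm
      refine (Set.OrdConnected.uIcc_subset (s := Ioo a b) inferInstance hmid ⟨h1, hlt⟩) hw
    refine hout w hwI ?_
    have hwC : S.toFun w = Q.arc i 0 :=
      (Q.eq_arc_iff le_rfl (Q.len_pos i).le).2 (by rw [hwx, sub_zero])
    rw [hwC, Q.arc_zero i k]
    exact hcen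
  have hsep : ∀ j k, j ≠ k → Q.len j + Q.len k ≤ |v j - v k| := by
    intro j k hjk
    have h := S.dist_le (v j) (v k)
    rwa [hvx, hvx, dist_leaf_leaf Q hjk] at h
  have hend : ∀ j, v j + Q.len j ≤ a + S.period := by
    intro j
    have := S.dist_le_of_le (hv j).2.le (hvx j) haL
    rw [dist_comm, dist_center_leaf] at this
    linarith
  have hbeg : ∀ j, b ≤ v j → b + Q.len j ≤ v j := by
    intro j hj
    have := S.dist_le_of_le hj hbC (hvx j)
    rw [dist_center_leaf] at this
    linarith
  -- If leaf i were missed as well, visits to all leaves, worth 2μ of time, would have to fit into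
  -- the shorter interval [b, a + 2μ].
  have hvi : v i < b := by
    by_contra hge
    have hall : ∀ j, b ≤ v j := fun j => by
      by_contra h
      exact hge ((hin j (not_le.1 h)) ▸ (not_le.1 h))
    have := sum_two_mul_le_of_separated Finset.univ v Q.len (a := b) (b := a + S.period) hb
      (fun j _ => hbeg j (hall j)) (fun j _ => hend j) (fun j _ => (Q.len_pos j).le)
      (fun j _ k _ => hsep j k)
    rw [sum_two_len_univ] at this
    linarith
  -- The other leaves need 2μ - 2ℓ_i after time b, so the excursion lasts at most 2ℓ_i; going to
  -- leaf i and back needs at least that much.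
  have hrest := sum_two_mul_le_of_separated (Finset.univ.erase i) v Q.len (a := b)
    (b := a + S.period) hb
    (fun j hj => hbeg j (not_lt.1 fun h => Finset.ne_of_mem_erase hj (hin j h)))
    (fun j _ => hend j) (fun j _ => (Q.len_pos j).le) (fun j _ k _ => hsep j k)
  have hsum : ∑ j ∈ Finset.univ.erase i, 2 * Q.len j = 2 * Q.totalLength - 2 * Q.len i := by
    rw [← sum_two_len_univ, ← Finset.add_sum_erase _ _ (Finset.mem_univ i)]
    ring
  have h1 := S.dist_le_of_le (hv i).1 haC (hvx i)
  have h2 := S.dist_le_of_le hvi.le (hvx i) hbC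
  rw [dist_center_leaf] at h1
  rw [dist_comm, dist_center_leaf] at h2
  exact ⟨i, hi, by linarith⟩

/-! ### Tours with inserted local tours -/

lemma LeafCondition.delay_eq (hQ : Q.LeafCondition α) (hα : 0 < α) (r : Set Q.Point → ℝ) (t : ℝ) :
    Q.delay α r t = ∑ K ∈ (hQ.finite_closureComponents hα).toFinset with r K < t,
      2 * Q.length.real K := by
  classical
  rw [delay, finsum_mem_eq_finite_toFinset_sum _
    ((hQ.finite_closureComponents hα).subset fun K hK => hK.1)]
  refine Finset.sum_congr ?_ fun _ _ => rfl
  ext K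
  simp

lemma LeafCondition.delay_nonneg (hQ : Q.LeafCondition α) (hα : 0 < α) (r : Set Q.Point → ℝ)
    (t : ℝ) : 0 ≤ Q.delay α r t := by
  rw [hQ.delay_eq hα]
  exact Finset.sum_nonneg fun K _ => mul_nonneg zero_le_two measureReal_nonneg

lemma LeafCondition.delay_mono (hQ : Q.LeafCondition α) (hα : 0 < α) (r : Set Q.Point → ℝ) :
    Monotone (Q.delay α r) := by
  intro t u htu
  rw [hQ.delay_eq hα, hQ.delay_eq hα]
  refine Finset.sum_le_sum_of_subset_of_nonneg (fun K hK => ?_)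
    fun K _ _ => mul_nonneg zero_le_two measureReal_nonneg
  simp only [Finset.mem_filter] at hK ⊢
  exact ⟨hK.1, hK.2.trans_le htu⟩

lemma LeafCondition.sum_closureComponents (hQ : Q.LeafCondition α) (hα : 0 < α) :
    ∑ K ∈ (hQ.finite_closureComponents hα).toFinset, 2 * Q.length.real K =
      2 * Q.length.real (Q.extremitySet α) := by
  rw [← hQ.finsum_closureComponents hα, finsum_mem_eq_finite_toFinset_sum]

lemma LeafCondition.delay_le (hQ : Q.LeafCondition α) (hα : 0 < α) (r : Set Q.Point → ℝ)
    (t : ℝ) : Q.delay α r t ≤ 2 * Q.length.real (Q.extremitySet α) := by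
  rw [hQ.delay_eq hα, ← hQ.sum_closureComponents hα]
  exact Finset.sum_le_sum_of_subset_of_nonneg (Finset.filter_subset _ _)
    fun K _ _ => mul_nonneg zero_le_two measureReal_nonneg

/-- The strict inequality in `delay` excludes the insertion at `r K` itself. -/
lemma LeafCondition.delay_add_le (hQ : Q.LeafCondition α) (hα : 0 < α) (r : Set Q.Point → ℝ)
    {K : Set Q.Point} (hK : K ∈ Q.closureComponents α) :
    Q.delay α r (r K) + 2 * Q.length.real K ≤ 2 * Q.length.real (Q.extremitySet α) := by
  classical
  have hK' : K ∈ (hQ.finite_closureComponents hα).toFinset := by simpa using hK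
  rw [hQ.delay_eq hα, ← hQ.sum_closureComponents hα,
    ← Finset.add_sum_erase _ _ hK', add_comm]
  refine add_le_add_right (Finset.sum_le_sum_of_subset_of_nonneg (fun K' hK' => ?_)
    fun K _ _ => mul_nonneg zero_le_two measureReal_nonneg) _
  simp only [Finset.mem_filter] at hK'
  refine Finset.mem_erase.2 ⟨fun h => ?_, hK'.1⟩
  rw [h] at hK'
  exact lt_irrefl _ hK'.2

lemma LeafCondition.exists_long_arc (hQ : Q.LeafCondition α) (hα : 0 < α)
    (h : closure (Q.extremitySet α) ≠ univ) : ∃ i, α / 2 < Q.len i := by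
  by_contra hno
  push Not at hno
  refine h (eq_univ_of_forall fun x => (hQ.mem_closure_extremitySet_iff hα).2 ?_)
  obtain ⟨i, t, h0, h1, rfl⟩ := Q.exists_eq_arc x
  refine ⟨i, ?_⟩
  rw [dist_arc_leaf_same Q h0 h1, extremityLength, min_eq_right (hno i)]
  linarith

/-- The duration between the two searches of a component. -/
lemma IsLocalSearch.duration (hQ : Q.LeafCondition α) (hα : 0 < α) (hbal : Q.IsBalanced)
    (hlong : ∃ i, α / 2 < Q.len i) {S : Q.ClosedPath} (hS : S.IsTour)
    (hper : S.period = 2 * Q.totalLength) {K : Set Q.Point} (hK : K ∈ Q.closureComponents α)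
    {s r : ℝ} (h : Q.IsLocalSearch α S K s r) :
    s + 2 * Q.length.real K ≤ r ∧ r ≤ S.period ∧ α ≤ r - s ∧
      r - s + α ≤ 2 * Q.totalLength + 2 * Q.length.real K := by
  obtain ⟨h0, h1, h2, h3, h4, h5⟩ := h
  rcases le_or_gt (α / 2) (Q.length.real K) with hle | hlt
  · obtain ⟨i, hi⟩ := hlong
    have := hbal i
    rw [h4 hle]
    exact ⟨le_rfl, h1, by linarith, by linarith⟩
  · obtain ⟨h6, h7, h8, h9⟩ := h5 hlt
    have hd : (0 : ℝ) ≤ Q.length.real K := measureReal_nonneg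
    obtain ⟨j, rfl⟩ : K ∈ range (Q.closureComponent α) := hQ.closureComponents_eq hα ▸ hK
    have hj : Q.len j ≤ α / 2 := by
      by_contra hj
      rw [length_closureComponent_of_lt hα (not_le.1 hj)] at hlt
      exact lt_irrefl _ hlt
    have hs : S.toFun (s + 2 * Q.length.real (Q.closureComponent α j)) ∈
        Q.closureComponent α j := by
      have := mem_image_of_mem S.toFun (right_mem_Icc.2
        (by linarith : s ≤ s + 2 * Q.length.real (Q.closureComponent α j)))
      rwa [h3] at this
    rw [closureComponent_of_le hj] at *
    -- A component shorter than α/2 is the union of the short arcs, so the two searches are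
    -- separated by a round trip of 2ℓ_i > α. Balance gives 2ℓ_i + α ≤ 2μ for the other way around.
    obtain ⟨i, hi, hi'⟩ := hS.excursion_eq hper h6 (by linarith) hs h8 h9
    have := hbal i
    exact ⟨h6.le, h7, by linarith, by linarith⟩

/-- A tour of an `E`-patrolling strategy visits every point twice, unless the closure of the
extremity set is the whole star. -/
lemma IsEPatrolTour.visitsTwice (hQ : Q.LeafCondition α) (hα : 0 < α) (hn : 0 < n)
    (hbal : Q.IsBalanced) (hne : closure (Q.extremitySet α) ≠ univ) {P : Q.ClosedPath}
    (hP : Q.IsEPatrolTour α P) :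
    P.period = 2 * (Q.totalLength + Q.length.real (Q.extremitySet α)) ∧
      ∀ x, P.VisitsTwice α x := by
  obtain ⟨S, hS, -, -, s, r, hloc, hper, hmain, hins⟩ := (hP.resolve_left fun h => hne h.1).2
  obtain ⟨hST, hSper⟩ := (ClosedPath.isCPT_iff hn).1 hS
  rw [hQ.finsum_closureComponents hα, hSper] at hper
  have hlong := hQ.exists_long_arc hα hne
  refine ⟨by rw [hper]; ring, fun x => ?_⟩
  by_cases hx : x ∈ closure (Q.extremitySet α)
  · obtain ⟨K, hK, hxK⟩ : ∃ K ∈ Q.closureComponents α, x ∈ K :=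
      ⟨_, ⟨x, hx, rfl⟩, mem_connectedComponentIn hx⟩
    obtain ⟨h1, h2, h3, h4⟩ := (hloc K hK).duration hQ hα hbal hlong hST hSper hK
    have himg := (hloc K hK).2.2.2.1
    have hs0 := (hloc K hK).1
    rw [← himg] at hxK
    obtain ⟨t, ht, htx⟩ := hxK
    have hd1 := hQ.delay_mono hα r (ht.2.trans h1)
    have hd2 := hQ.delay_nonneg hα r t
    have hd3 := hQ.delay_add_le hα r hK
    -- The same point of the local tour, once in the original search and once in the inserted copy.
    refine ⟨t + Q.delay α r t, r K + Q.delay α r (r K) + (t - s K), ?_, ?_, by linarith,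
      by rw [hper]; linarith⟩
    · rw [hmain t ⟨by linarith [ht.1], by linarith [ht.2]⟩, htx]
    · rw [hins K hK _ ⟨by linarith [ht.1], by linarith [ht.2]⟩, add_sub_cancel, htx]
  · have hPT : P.IsTour := by
      intro y
      obtain ⟨t, ht, hty⟩ := hST y
      refine ⟨t + Q.delay α r t, ⟨add_nonneg ht.1 (hQ.delay_nonneg hα r t), ?_⟩, ?_⟩
      · rw [hper]
        linarith [ht.2, hQ.delay_le hα r t]
      · rw [hmain t ht, hty]
    obtain ⟨i, p, hp0, hp1, rfl⟩ := Q.exists_eq_arc x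
    rw [hQ.mem_closure_extremitySet_iff hα] at hx
    push Not at hx
    have h1 := hx i
    rw [dist_arc_leaf_same Q hp0 hp1] at h1
    refine hPT.visitsTwice (hbal i) hp0 ?_ hα
    rcases min_lt_iff.1 h1 with h | h
    · linarith
    · linarith

/-- The tours of `E`-patrolling strategies intercept every attack with the claimed
probability. -/
lemma IsEPatrolTour.le_randomized (hQ : Q.LeafCondition α) (hα : 0 < α) (hn : 0 < n)
    (hα' : α < 2 * Q.totalLength) (h : Q.IsBalanced ∨ ∀ i, 2 * Q.len i ≤ α) {P : Q.ClosedPath}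
    (hP : Q.IsEPatrolTour α P) (a : Q.Attack) :
    ENNReal.ofReal (α / (Q.totalLength + Q.length.real (Q.extremitySet α))) ≤
      P.randomized {S | Q.Intercepts α S a} := by
  by_cases hcl : closure (Q.extremitySet α) = univ
  · have hCPT := (hP.resolve_right fun h => h.1 hcl).2
    obtain ⟨hT, hper⟩ := (ClosedPath.isCPT_iff hn).1 hCPT
    have hshort : ∀ i, Q.len i ≤ α / 2 := by
      intro i
      by_contra hi
      rw [not_le] at hi
      -- The test point is the midpoint of the part of arc i beyond α/2 from its leaf.
      have hmem : Q.arc i ((Q.len i - α / 2) / 2) ∈ closure (Q.extremitySet α) :=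
        hcl ▸ mem_univ _
      obtain ⟨j, hj⟩ := (hQ.mem_closure_extremitySet_iff hα).1 hmem
      by_cases hij : i = j
      · subst hij
        rw [dist_arc_leaf_same Q (by linarith) (by linarith)] at hj
        linarith [Q.extremityLength_le_half (α := α) i]
      · rw [dist_arc_leaf_ne Q hij (by linarith) (by linarith)] at hj
        linarith [Q.extremityLength_le_len (α := α) j]
    have hE : Q.length.real (Q.extremitySet α) = Q.totalLength := by
      rw [hQ.length_extremitySet hα, totalLength]
      exact Finset.sum_congr rfl fun i _ => min_eq_right (hshort i)
    have := hT.le_randomized hα (by rw [hper]; exact hα'.le) a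
    rwa [hper, two_mul, ← congrArg (Q.totalLength + ·) hE] at this
  · have hbal : Q.IsBalanced := by
      refine h.resolve_right fun h => ?_
      obtain ⟨i, hi⟩ := hQ.exists_long_arc hα hcl
      linarith [h i]
    obtain ⟨hper, htw⟩ := hP.visitsTwice hQ hα hn hbal hcl
    have := (htw a.1).le_randomized hα
    rwa [hper, mul_div_mul_left _ _ two_ne_zero] at this

/-! ### Insertion of local tours into a closed path -/

/-- A closed path given on one period. -/
lemma exists_closedPath {g : ℝ → Q.Point} {L : ℝ} (hL : 0 < L)
    (hg : ∀ t ∈ Icc 0 L, ∀ u ∈ Icc 0 L, dist (g t) (g u) ≤ |t - u|) (h0 : g 0 = g L) :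
    ∃ P : Q.ClosedPath, P.period = L ∧ ∀ t ∈ Icc 0 L, P.toFun t = g t := by
  have hmem : ∀ t, toIcoMod hL 0 t ∈ Ico 0 L := fun t => by
    simpa using toIcoMod_mem_Ico hL 0 t
  have key : ∀ t u, t ≤ u → dist (g (toIcoMod hL 0 t)) (g (toIcoMod hL 0 u)) ≤ u - t := by
    intro t u htu
    have ht := hmem t
    have hu := hmem u
    have ht' := toIcoMod_add_toIcoDiv_zsmul hL 0 t
    have hu' := toIcoMod_add_toIcoDiv_zsmul hL 0 u
    rw [zsmul_eq_mul] at ht' hu'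
    rcases lt_trichotomy (toIcoDiv hL 0 t) (toIcoDiv hL 0 u) with h | h | h
    -- In different periods the two points are joined through the common end point g L = g 0.
    · have h1 : ((toIcoDiv hL 0 t : ℝ) + 1) ≤ toIcoDiv hL 0 u := by exact_mod_cast h
      have h2 := hg _ (Ico_subset_Icc_self ht) L (right_mem_Icc.2 hL.le)
      have h3 := hg 0 (left_mem_Icc.2 hL.le) _ (Ico_subset_Icc_self hu)
      rw [abs_sub_comm, abs_of_nonneg (by linarith [ht.2])] at h2
      rw [abs_sub_comm, abs_of_nonneg (by linarith [hu.1]), h0] at h3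
      have h4 := dist_triangle (g (toIcoMod hL 0 t)) (g L) (g (toIcoMod hL 0 u))
      nlinarith
    · rw [h] at ht'
      have h2 := hg _ (Ico_subset_Icc_self ht) _ (Ico_subset_Icc_self hu)
      rw [abs_sub_comm, abs_of_nonneg (by linarith)] at h2
      linarith
    · exfalso
      have h1 : ((toIcoDiv hL 0 u : ℝ) + 1) ≤ toIcoDiv hL 0 t := by exact_mod_cast h
      nlinarith [ht.1, hu.2]
  refine ⟨⟨fun t => g (toIcoMod hL 0 t), L, hL, LipschitzWith.of_dist_le_mul fun t u => ?_,
    fun t => by simp only [toIcoMod_add_right]⟩, rfl, fun t ht => ?_⟩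
  · rw [NNReal.coe_one, one_mul, Real.dist_eq]
    rcases le_total t u with h | h
    · rw [abs_sub_comm, abs_of_nonneg (by linarith)]
      exact key t u h
    · rw [dist_comm, abs_of_nonneg (by linarith)]
      exact key u t h
  · show g (toIcoMod hL 0 t) = g t
    rcases ht.2.eq_or_lt with rfl | h
    · rw [← h0]
      congr 1
      have := toIcoMod_add_right hL (0 : ℝ) 0
      rw [zero_add] at this
      rw [this, toIcoMod_apply_left]
    · rw [(toIcoMod_eq_self hL).2 ⟨ht.1, by simpa using h⟩]

section Insertion

variable {X κ : Type*}

/-- The total duration of the insertions before time `t`. -/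
def insertDelay (A : Finset κ) (r d : κ → ℝ) (t : ℝ) : ℝ := ∑ K ∈ A with r K < t, d K

/-- `y` is the position at time `u` on the path `f` with inserted copies of the local tours
`f (s K + v)`, `0 ≤ v ≤ d K`, at the times `r K`. -/
def InsertRel (A : Finset κ) (f : ℝ → X) (L : ℝ) (r s d : κ → ℝ) (u : ℝ) (y : X) : Prop :=
  (∃ t ∈ Icc 0 L, u = t + insertDelay A r d t ∧ y = f t) ∨
    ∃ K ∈ A, ∃ v ∈ Icc 0 (d K), u = r K + insertDelay A r d (r K) + v ∧ y = f (s K + v)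

variable {A : Finset κ} {f : ℝ → X} {L : ℝ} {r s d : κ → ℝ}

lemma insertDelay_mono (hd : ∀ K ∈ A, 0 ≤ d K) : Monotone (insertDelay A r d) := by
  intro t u htu
  refine Finset.sum_le_sum_of_subset_of_nonneg (fun K hK => ?_)
    fun K hK _ => hd K (Finset.mem_filter.1 hK).1
  simp only [Finset.mem_filter] at hK ⊢
  exact ⟨hK.1, hK.2.trans_le htu⟩

lemma insertDelay_add_le (hd : ∀ K ∈ A, 0 ≤ d K) {K : κ} (hK : K ∈ A) {t : ℝ} (h : r K < t) :
    insertDelay A r d (r K) + d K ≤ insertDelay A r d t := by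
  classical
  rw [insertDelay, add_comm, ← Finset.sum_insert (by simp)]
  refine Finset.sum_le_sum_of_subset_of_nonneg (fun K' hK' => ?_)
    fun K hK _ => hd K (Finset.mem_filter.1 hK).1
  rcases Finset.mem_insert.1 hK' with rfl | hK'
  · simp [hK, h]
  · simp only [Finset.mem_filter] at hK' ⊢
    exact ⟨hK'.1, hK'.2.trans h⟩

/-- For u = u' this says that the relation is single valued, so one estimate gives both consistency
of overlapping prescriptions and the Lipschitz property. Every inserted tour is attached at f (r K),
through which the estimates are routed. -/
lemma insertRel_dist [PseudoMetricSpace X] (hf : ∀ t u, dist (f t) (f u) ≤ |t - u|)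
    (hd : ∀ K ∈ A, 0 ≤ d K) (hr : ∀ K ∈ A, ∀ K' ∈ A, r K = r K' → K = K')
    (hs : ∀ K ∈ A, f (s K) = f (r K) ∧ f (s K + d K) = f (r K))
    {u u' : ℝ} {y y' : X} (h : InsertRel A f L r s d u y) (h' : InsertRel A f L r s d u' y') :
    dist y y' ≤ |u - u'| := by
  have hmono := insertDelay_mono (r := r) hd
  have hbeg : ∀ K ∈ A, ∀ v ∈ Icc 0 (d K), dist (f (r K)) (f (s K + v)) ≤ v := by
    intro K hK v hv
    rw [← (hs K hK).1]
    refine (hf _ _).trans (le_of_eq ?_)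
    rw [sub_add_cancel_left, abs_neg, abs_of_nonneg hv.1]
  have hend : ∀ K ∈ A, ∀ v ∈ Icc 0 (d K), dist (f (s K + v)) (f (r K)) ≤ d K - v := by
    intro K hK v hv
    rw [← (hs K hK).2]
    refine (hf _ _).trans (le_of_eq ?_)
    rw [add_sub_add_left_eq_sub, abs_sub_comm, abs_of_nonneg (by linarith [hv.2])]
  have hmi : ∀ t, ∀ K ∈ A, ∀ v ∈ Icc 0 (d K), dist (f t) (f (s K + v)) ≤
      |(t + insertDelay A r d t) - (r K + insertDelay A r d (r K) + v)| := by
    intro t K hK v hv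
    rcases le_or_gt t (r K) with h | h
    · rw [abs_sub_comm]
      refine le_trans ?_ (le_abs_self _)
      have h1 := hf t (r K)
      rw [abs_sub_comm, abs_of_nonneg (by linarith)] at h1
      linarith [dist_triangle (f t) (f (r K)) (f (s K + v)), hbeg K hK v hv, hmono h]
    · refine le_trans ?_ (le_abs_self _)
      have h1 := hf (r K) t
      rw [abs_sub_comm, abs_of_nonneg (by linarith)] at h1
      rw [dist_comm]
      linarith [dist_triangle (f (s K + v)) (f (r K)) (f t), hend K hK v hv,
        insertDelay_add_le hd hK h]
  have hii : ∀ K ∈ A, ∀ v ∈ Icc 0 (d K), ∀ K' ∈ A, ∀ v' ∈ Icc 0 (d K'), r K < r K' →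
      dist (f (s K + v)) (f (s K' + v')) ≤
        (r K' + insertDelay A r d (r K') + v') - (r K + insertDelay A r d (r K) + v) := by
    intro K hK v hv K' hK' v' hv' h
    have h1 := hf (r K) (r K')
    rw [abs_sub_comm, abs_of_nonneg (by linarith)] at h1
    linarith [dist_triangle4 (f (s K + v)) (f (r K)) (f (r K')) (f (s K' + v')),
      hend K hK v hv, hbeg K' hK' v' hv', insertDelay_add_le hd hK h]
  rcases h with ⟨t, -, rfl, rfl⟩ | ⟨K, hK, v, hv, rfl, rfl⟩
  · rcases h' with ⟨t', -, rfl, rfl⟩ | ⟨K', hK', v', hv', rfl, rfl⟩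
    · refine (hf t t').trans ?_
      rcases le_total t t' with h | h
      · rw [abs_sub_comm, abs_of_nonneg (by linarith), abs_sub_comm]
        refine le_trans ?_ (le_abs_self _)
        linarith [hmono h]
      · rw [abs_of_nonneg (by linarith)]
        refine le_trans ?_ (le_abs_self _)
        linarith [hmono h]
    · exact hmi t K' hK' v' hv'
  · rcases h' with ⟨t', -, rfl, rfl⟩ | ⟨K', hK', v', hv', rfl, rfl⟩
    · rw [dist_comm, abs_sub_comm]
      exact hmi t' K hK v hv
    · rcases lt_trichotomy (r K) (r K') with h | h | h
      · rw [abs_sub_comm]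
        exact (hii K hK v hv K' hK' v' hv' h).trans (le_abs_self _)
      · obtain rfl := hr K hK K' hK' h
        refine (hf _ _).trans (le_of_eq ?_)
        congr 1
        ring
      · rw [dist_comm]
        exact (hii K' hK' v' hv' K hK v hv h).trans (le_abs_self _)

/-- Induction on the insertions, removing the latest one: times before it are unaffected, times
during it are covered by it, and later times are shifted by its duration. -/
lemma exists_insertRel (hd : ∀ K ∈ A, 0 ≤ d K)
    (hr : ∀ K ∈ A, ∀ K' ∈ A, r K = r K' → K = K') (hrL : ∀ K ∈ A, 0 ≤ r K ∧ r K < L)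
    {u : ℝ} (hu : u ∈ Icc 0 (L + ∑ K ∈ A, d K)) : ∃ y, InsertRel A f L r s d u y := by
  classical
  have main : ∀ u ∈ Icc 0 (L + ∑ K ∈ A, d K),
      (∃ t ∈ Icc 0 L, u = t + insertDelay A r d t) ∨
      ∃ K ∈ A, ∃ v ∈ Icc 0 (d K), u = r K + insertDelay A r d (r K) + v := by
    clear hu
    induction A using Finset.induction_on_max_value r with
    | empty =>
      intro u hu
      exact Or.inl ⟨u, by simpa using hu, by simp [insertDelay]⟩
    | insert K A hKA hmax ih =>
      intro u hu
      have hdA : ∀ K ∈ A, 0 ≤ d K := fun K' h => hd K' (Finset.mem_insert_of_mem h)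
      have ih' := ih hdA
        (fun K' h K'' h' => hr K' (Finset.mem_insert_of_mem h) K'' (Finset.mem_insert_of_mem h'))
        (fun K' h => hrL K' (Finset.mem_insert_of_mem h))
      have hmono := insertDelay_mono (r := r) hdA
      have hdK := hd K (Finset.mem_insert_self _ _)
      have hrK := hrL K (Finset.mem_insert_self _ _)
      have hle : ∀ t, t ≤ r K → insertDelay (insert K A) r d t = insertDelay A r d t := by
        intro t ht
        rw [insertDelay, insertDelay, Finset.filter_insert, if_neg (not_lt.2 ht)]
      have hgt : ∀ t, r K < t →
          insertDelay (insert K A) r d t = insertDelay A r d t + d K := by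
        intro t ht
        rw [insertDelay, insertDelay, Finset.filter_insert, if_pos ht,
          Finset.sum_insert (by simp [hKA]), add_comm]
      rw [Finset.sum_insert hKA] at hu
      have hDL : insertDelay A r d (r K) ≤ ∑ K ∈ A, d K :=
        Finset.sum_le_sum_of_subset_of_nonneg (Finset.filter_subset _ _) fun K hK _ => hdA K hK
      rcases le_or_gt u (r K + insertDelay A r d (r K)) with h1 | h1
      · rcases ih' u ⟨hu.1, by linarith⟩ with ⟨t, ht, rfl⟩ | ⟨K', hK', v, hv, rfl⟩
        · refine Or.inl ⟨t, ht, ?_⟩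
          rw [hle]
          by_contra h
          linarith [hmono (not_le.1 h).le]
        · exact Or.inr ⟨K', Finset.mem_insert_of_mem hK', v, hv, by rw [hle _ (hmax K' hK')]⟩
      · rcases le_or_gt u (r K + insertDelay A r d (r K) + d K) with h2 | h2
        · refine Or.inr ⟨K, Finset.mem_insert_self _ _, u - (r K + insertDelay A r d (r K)),
            ⟨by linarith, by linarith⟩, ?_⟩
          rw [hle _ le_rfl]
          ring
        · rcases ih' (u - d K) ⟨by
            have : 0 ≤ insertDelay A r d (r K) :=
              Finset.sum_nonneg fun K hK => hdA K (Finset.mem_filter.1 hK).1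
            linarith, by linarith [hu.2]⟩ with ⟨t, ht, htu⟩ | ⟨K', hK', v, hv, hvu⟩
          · refine Or.inl ⟨t, ht, ?_⟩
            rw [hgt]
            · linarith
            · by_contra h
              linarith [hmono (not_lt.1 h)]
          -- After the latest insertion point no earlier inserted tour is still running.
          · exfalso
            have hne : r K' ≠ r K := fun h => hKA <| by
              rwa [← hr K' (Finset.mem_insert_of_mem hK') K (Finset.mem_insert_self _ _) h]
            have hlt := lt_of_le_of_ne (hmax K' hK') hne
            linarith [insertDelay_add_le hdA hK' hlt, hv.2]
  rcases main u hu with ⟨t, ht, h⟩ | ⟨K, hK, v, hv, h⟩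
  · exact ⟨f t, Or.inl ⟨t, ht, h, rfl⟩⟩
  · exact ⟨f (s K + v), Or.inr ⟨K, hK, v, hv, h, rfl⟩⟩

end Insertion

/-- Local tours can be inserted into a closed path at later visits of their starting points. -/
lemma ClosedPath.exists_insertion {κ : Type*} (S : Q.ClosedPath) {A : Finset κ} {r s d : κ → ℝ}
    (hd : ∀ K ∈ A, 0 ≤ d K) (hr : ∀ K ∈ A, ∀ K' ∈ A, r K = r K' → K = K')
    (hrL : ∀ K ∈ A, 0 ≤ r K ∧ r K < S.period)
    (hs : ∀ K ∈ A, S.toFun (s K) = S.toFun (r K) ∧ S.toFun (s K + d K) = S.toFun (r K)) :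
    ∃ P : Q.ClosedPath, P.period = S.period + ∑ K ∈ A, d K ∧
      (∀ t ∈ Icc 0 S.period, P.toFun (t + insertDelay A r d t) = S.toFun t) ∧
      ∀ K ∈ A, ∀ v ∈ Icc 0 (d K),
        P.toFun (r K + insertDelay A r d (r K) + v) = S.toFun (s K + v) := by
  have hL := S.period_pos
  have hex := fun u (hu : u ∈ Icc 0 (S.period + ∑ K ∈ A, d K)) =>
    exists_insertRel (f := S.toFun) (s := s) hd hr hrL hu
  have : Nonempty Q.Point := ⟨S.toFun 0⟩
  choose! g hg using hex
  have hdist := fun {u u' y y'} => insertRel_dist (L := S.period) (u := u) (u' := u') (y := y)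
    (y' := y') S.dist_le hd hr hs
  have hsum : 0 ≤ ∑ K ∈ A, d K := Finset.sum_nonneg hd
  have hval : ∀ u ∈ Icc 0 (S.period + ∑ K ∈ A, d K), ∀ y,
      InsertRel A S.toFun S.period r s d u y → g u = y := by
    intro u hu y hy
    have := hdist (hg u hu) hy
    rw [sub_self, abs_zero] at this
    exact dist_le_zero.1 this
  have hD0 : ∀ t, 0 ≤ insertDelay A r d t := fun t =>
    Finset.sum_nonneg fun K hK => hd K (Finset.mem_filter.1 hK).1
  have hD1 : ∀ t, insertDelay A r d t ≤ ∑ K ∈ A, d K := fun t =>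
    Finset.sum_le_sum_of_subset_of_nonneg (Finset.filter_subset _ _) fun K hK _ => hd K hK
  have hmain : ∀ t ∈ Icc 0 S.period,
      t + insertDelay A r d t ∈ Icc 0 (S.period + ∑ K ∈ A, d K) ∧
      g (t + insertDelay A r d t) = S.toFun t := by
    intro t ht
    have hmem : t + insertDelay A r d t ∈ Icc 0 (S.period + ∑ K ∈ A, d K) :=
      ⟨add_nonneg ht.1 (hD0 t), add_le_add ht.2 (hD1 t)⟩
    exact ⟨hmem, hval _ hmem _ (Or.inl ⟨t, ht, rfl, rfl⟩)⟩
  have hins : ∀ K ∈ A, ∀ v ∈ Icc 0 (d K),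
      r K + insertDelay A r d (r K) + v ∈ Icc 0 (S.period + ∑ K ∈ A, d K) ∧
      g (r K + insertDelay A r d (r K) + v) = S.toFun (s K + v) := by
    intro K hK v hv
    have hmem : r K + insertDelay A r d (r K) + v ∈ Icc 0 (S.period + ∑ K ∈ A, d K) := by
      have h1 := hD0 (r K)
      have h2 := insertDelay_add_le hd hK (hrL K hK).2
      have h3 := hD1 S.period
      exact ⟨by linarith [(hrL K hK).1, hv.1], by linarith [(hrL K hK).2, hv.2]⟩
    exact ⟨hmem, hval _ hmem _ (Or.inr ⟨K, hK, v, hv, rfl, rfl⟩)⟩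
  have hbeg : g 0 = S.toFun 0 := by
    have h := (hmain 0 (left_mem_Icc.2 hL.le)).2
    have h0 : insertDelay A r d 0 = 0 := by
      rw [insertDelay, Finset.filter_false_of_mem fun K hK => not_lt.2 (hrL K hK).1,
        Finset.sum_empty]
    rwa [h0, zero_add] at h
  have hend : g (S.period + ∑ K ∈ A, d K) = S.toFun 0 := by
    have h := (hmain S.period (right_mem_Icc.2 hL.le)).2
    -- All insertions happen strictly before the end of the period, so the full delay has
    -- accumulated there and the new path closes up.
    have h0 : insertDelay A r d S.period = ∑ K ∈ A, d K := by
      rw [insertDelay, Finset.filter_true_of_mem fun K hK => (hrL K hK).2]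
    rwa [h0, S.periodic.eq] at h
  obtain ⟨P, hP, hPg⟩ := exists_closedPath (g := g) (by linarith)
    (fun t ht u hu => hdist (hg t ht) (hg u hu)) (hbeg.trans hend.symm)
  refine ⟨P, hP, fun t ht => ?_, fun K hK v hv => ?_⟩
  · rw [hPg _ (hmain t ht).1, (hmain t ht).2]
  · rw [hPg _ (hins K hK v hv).1, (hins K hK v hv).2]

/-- A tour whose local tours end where they are resumed gives rise to an `E`-patrolling
strategy. -/
lemma LeafCondition.exists_isEPatrolTour_of_localSearch (hQ : Q.LeafCondition α) (hα : 0 < α)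
    (hbal : Q.IsBalanced) (hne : closure (Q.extremitySet α) ≠ univ) {S : Q.ClosedPath}
    (hn : 0 < n) (hS : S.IsCPT) (hreg : Q.IsRegular (S.toFun 0))
    (hout : S.toFun 0 ∉ closure (Q.extremitySet α))
    (hloc : ∀ K ∈ Q.closureComponents α, ∃ s r, Q.IsLocalSearch α S K s r ∧
      S.toFun s = S.toFun r) : ∃ P : Q.ClosedPath, Q.IsEPatrolTour α P := by
  choose! s r hsr hend using hloc
  obtain ⟨hST, hSper⟩ := (ClosedPath.isCPT_iff hn).1 hS
  have hfin := hQ.finite_closureComponents hα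
  have hlong := hQ.exists_long_arc hα hne
  have hmemK : ∀ K ∈ Q.closureComponents α, S.toFun (r K) ∈ K := by
    intro K hK
    have hd : (0 : ℝ) ≤ Q.length.real K := measureReal_nonneg
    have := mem_image_of_mem S.toFun (left_mem_Icc.2
      (by linarith : s K ≤ s K + 2 * Q.length.real K))
    rwa [(hsr K hK).2.2.2.1, hend K hK] at this
  obtain ⟨P, hP, hmain, hins⟩ := S.exists_insertion (A := hfin.toFinset) (r := r) (s := s)
    (d := fun K => 2 * Q.length.real K) (fun K _ => mul_nonneg zero_le_two measureReal_nonneg)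
    (fun K hK K' hK' h => by
      rw [Set.Finite.mem_toFinset] at hK hK'
      have h' := hmemK K' hK'
      rw [← h] at h'
      exact eq_of_mem_closureComponents hK hK' (hmemK K hK) h')
    (fun K hK => by
      rw [Set.Finite.mem_toFinset] at hK
      have hd : (0 : ℝ) ≤ Q.length.real K := measureReal_nonneg
      obtain ⟨h1, h2, -, -⟩ := (hsr K hK).duration hQ hα hbal hlong hST hSper hK
      -- An insertion time equal to the period would put the starting point of the tour into K, but
      -- it lies outside the closure of E.
      refine ⟨by linarith [(hsr K hK).1], lt_of_le_of_ne h2 fun h => hout ?_⟩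
      have h3 := hmemK K hK
      rw [h, S.periodic.eq] at h3
      obtain ⟨y, -, rfl⟩ := hK
      exact connectedComponentIn_subset _ _ h3)
    (fun K hK => by
      rw [Set.Finite.mem_toFinset] at hK
      exact ⟨hend K hK, by rw [← (hsr K hK).2.2.1, hend K hK]⟩)
  have hdelay : ∀ t, insertDelay hfin.toFinset r (fun K => 2 * Q.length.real K) t =
      Q.delay α r t := fun t => (hQ.delay_eq hα r t).symm
  simp only [hdelay] at hmain hins
  refine ⟨P, Or.inr ⟨hne, S, hS, hreg, hout, s, r, hsr, ?_, hmain, fun K hK => ?_⟩⟩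
  · rw [hP, finsum_mem_eq_finite_toFinset_sum]
  · exact hins K ((Set.Finite.mem_toFinset _).2 hK)

/-! ### The ordered tour searches every component in a local tour -/

lemma len_le_circleDist_orderedVisit {p c : ℝ} {j : Fin n} (hc0 : 0 ≤ c)
    (hc : c ≤ 2 * Q.totalLength) (h : Q.arcStart j + 2 * Q.len j ≤ c ∨ c ≤ Q.arcStart j) :
    Q.len j ≤ Q.circleDist (Q.orderedVisit p) j (p + c) := by
  have h1 := arcStart_nonneg j (Q := Q)
  have h2 := arcStart_add_le j (Q := Q)
  have h3 := Q.len_pos j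
  have heq : p + c - Q.orderedVisit p j = c - Q.arcStart j - Q.len j := by
    rw [orderedVisit]; ring
  rw [circleDist, heq]
  rcases h with h | h
  · apply le_norm_addCircle
    · rw [abs_of_nonneg] <;> linarith
    · rw [abs_of_nonneg] <;> linarith
    · exact mul_nonneg zero_le_two Q.totalLength_nonneg
  · apply le_norm_addCircle
    · rw [abs_of_nonpos] <;> linarith
    · rw [abs_of_nonpos] <;> linarith
    · exact mul_nonneg zero_le_two Q.totalLength_nonneg

variable (Q) in
/-- The tour that starts from the center at time `p` and searches the arcs in the order of their
lengths. -/
def orderedTour (hn : 0 < n) (p : ℝ) : Q.ClosedPath :=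
  (isSeparated_orderedVisit (Q := Q) p).tour hn

lemma orderedTour_eq_center (hn : 0 < n) {p c : ℝ} (hc0 : 0 ≤ c) (hc : c ≤ 2 * Q.totalLength)
    (h : ∀ j, Q.arcStart j + 2 * Q.len j ≤ c ∨ c ≤ Q.arcStart j) :
    (Q.orderedTour hn p).toFun (p + c) = Q.arc ⟨0, hn⟩ 0 :=
  tourPoint_eq_center hn fun j => len_le_circleDist_orderedVisit hc0 hc (h j)

lemma orderedTour_apply (hn : 0 < n) (p : ℝ) (i : Fin n) {t : ℝ}
    (h : |t - Q.orderedVisit p i| ≤ Q.len i) :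
    (Q.orderedTour hn p).toFun t = Q.arc i (Q.len i - |t - Q.orderedVisit p i|) :=
  IsSeparated.tour_apply hn _ i h

lemma dist_orderedTour_leaf (hn : 0 < n) (p : ℝ) (i : Fin n) {t : ℝ}
    (h : |t - Q.orderedVisit p i| ≤ Q.len i) :
    dist ((Q.orderedTour hn p).toFun t) (Q.leaf i) = |t - Q.orderedVisit p i| := by
  rw [orderedTour_apply hn p i h, dist_arc_leaf_same Q (by linarith)
    (by linarith [abs_nonneg (t - Q.orderedVisit p i)]), sub_sub_cancel]

lemma orderedTour_image (hn : 0 < n) (p : ℝ) (i : Fin n) {c : ℝ} (hc : c ≤ Q.len i) :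
    (Q.orderedTour hn p).toFun '' Icc (Q.orderedVisit p i - c) (Q.orderedVisit p i + c) =
      {x | dist x (Q.leaf i) ≤ c} := by
  ext x
  constructor
  · rintro ⟨t, ht, rfl⟩
    have : |t - Q.orderedVisit p i| ≤ c := abs_le.2 ⟨by linarith [ht.1], by linarith [ht.2]⟩
    rw [mem_ofPred_eq, dist_orderedTour_leaf hn p i (this.trans hc)]
    exact this
  · intro hx
    rw [mem_ofPred_eq] at hx
    have h0 : 0 ≤ dist x (Q.leaf i) := dist_nonneg
    have h1 : |Q.orderedVisit p i + dist x (Q.leaf i) - Q.orderedVisit p i| =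
        dist x (Q.leaf i) := by
      rw [add_sub_cancel_left, abs_of_nonneg h0]
    refine ⟨Q.orderedVisit p i + dist x (Q.leaf i), ⟨by linarith, by linarith⟩, ?_⟩
    rw [orderedTour_apply hn p i (by rw [h1]; exact hx.trans hc), h1]
    exact (Q.eq_arc_of_dist_leaf_le (hx.trans hc)).symm

lemma arcStart_of_isMax {i : Fin n} (hi : ∀ j, Q.arcKey j ≤ Q.arcKey i) :
    Q.arcStart i + 2 * Q.len i = 2 * Q.totalLength := by
  refine le_antisymm (arcStart_add_le i) ?_
  have : (Finset.univ.filter fun j => Q.arcKey j < Q.arcKey i) = Finset.univ.erase i := by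
    ext j
    simp only [Finset.mem_filter, Finset.mem_univ, true_and, Finset.mem_erase, and_true]
    exact ⟨fun h h' => by subst h'; exact lt_irrefl _ h,
      fun h => lt_of_le_of_ne (hi j) (arcKey_injective.ne h)⟩
  rw [arcStart, this, ← sum_two_len_univ, ← Finset.add_sum_erase _ _ (Finset.mem_univ i),
    add_comm]

/-- The second copy follows the first immediately, since λ(K) = α/2. The bound on p ensures that
even on the longest arc, searched last, the local tour ends by time 2μ. -/
lemma isLocalSearch_leaf (hα : 0 < α) (hn : 0 < n) {i₀ i : Fin n}
    (hmax : ∀ j, Q.arcKey j ≤ Q.arcKey i₀) {p : ℝ} (hp0 : 0 ≤ p) (hp : p ≤ Q.len i₀ - α / 2)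
    (hi : α / 2 < Q.len i) :
    Q.IsLocalSearch α (Q.orderedTour hn p) (Q.closureComponent α i)
      (Q.orderedVisit p i - α / 2) (Q.orderedVisit p i + α / 2) ∧
    (Q.orderedTour hn p).toFun (Q.orderedVisit p i - α / 2) =
      (Q.orderedTour hn p).toFun (Q.orderedVisit p i + α / 2) := by
  have hstart := arcStart_nonneg i (Q := Q)
  have h0 : 0 ≤ Q.orderedVisit p i - α / 2 := by
    rw [orderedVisit]; linarith
  have hend : Q.orderedVisit p i + α / 2 ≤ 2 * Q.totalLength := by
    have h1 := arcStart_of_isMax hmax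
    rw [orderedVisit]
    by_cases h : i = i₀
    · subst h; linarith
    · have := arcStart_add_le_arcStart (lt_of_le_of_ne (hmax i) (arcKey_injective.ne h))
      linarith
  have heq : (Q.orderedTour hn p).toFun (Q.orderedVisit p i - α / 2) =
      (Q.orderedTour hn p).toFun (Q.orderedVisit p i + α / 2) := by
    have h1 : |Q.orderedVisit p i - α / 2 - Q.orderedVisit p i| = α / 2 := by
      rw [sub_sub_cancel_left, abs_neg, abs_of_pos (by linarith)]
    have h2 : |Q.orderedVisit p i + α / 2 - Q.orderedVisit p i| = α / 2 := by
      rw [add_sub_cancel_left, abs_of_pos (by linarith)]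
    rw [orderedTour_apply hn p i (by linarith), orderedTour_apply hn p i (by linarith), h1, h2]
  have htime : Q.orderedVisit p i - α / 2 + 2 * (α / 2) = Q.orderedVisit p i + α / 2 := by ring
  refine ⟨?_, heq⟩
  rw [IsLocalSearch, length_closureComponent_of_lt hα hi, htime]
  refine ⟨h0, hend, heq, ?_, fun _ => rfl, fun h => absurd h (lt_irrefl _)⟩
  rw [orderedTour_image hn p i hi.le, closureComponent_of_lt hi]

/-- The short arcs are searched first. -/
lemma orderedTour_image_shortArcs (hn : 0 < n) (p : ℝ) {i : Fin n} (hi : Q.len i ≤ α / 2) :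
    (Q.orderedTour hn p).toFun '' Icc p (p + ∑ j with Q.len j ≤ α / 2, 2 * Q.len j) =
      Q.shortArcs α := by
  ext x
  constructor
  · rintro ⟨t, ht, rfl⟩
    by_cases hex : ∃ j, Q.len j ≤ α / 2 ∧ Q.circleDist (Q.orderedVisit p) j t ≤ Q.len j
    · obtain ⟨j, hj, hjt⟩ := hex
      refine ⟨j, hj, ?_⟩
      rw [orderedTour, IsSeparated.tour]
      simp only
      rw [(isSeparated_orderedVisit p).tourPoint_eq hn hjt, dist_arc_leaf_same Q (by linarith)
        (by linarith [circleDist_nonneg (Q := Q) (Q.orderedVisit p) j t])]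
      linarith
    · push Not at hex
      have hcen : (Q.orderedTour hn p).toFun t = Q.arc ⟨0, hn⟩ 0 := by
        refine tourPoint_eq_center hn fun j => ?_
        rcases le_or_gt (Q.len j) (α / 2) with hj | hj
        · exact (hex j hj).le
        -- Long arcs are started only after all short ones are finished, hence not before the end of
        -- this time interval.
        · have hsum : ∑ j with Q.len j ≤ α / 2, 2 * Q.len j ≤ Q.arcStart j := by
            refine sum_two_len_le fun k hk => ?_
            simp only [Finset.mem_filter, Finset.mem_univ, true_and] at hk ⊢
            exact arcKey_lt_of_len_lt (hk.trans_lt hj)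
          have h2 := arcStart_add_le j (Q := Q)
          have := len_le_circleDist_orderedVisit (Q := Q) (p := p) (c := t - p) (j := j)
            (by linarith [ht.1]) (by linarith [ht.2, Q.len_pos j])
            (Or.inr (by linarith [ht.2]))
          rwa [add_sub_cancel] at this
      rw [hcen]
      exact ⟨i, hi, by rw [dist_center_leaf]⟩
  · rintro ⟨j, hj, hjx⟩
    have hmem : x ∈ {x | dist x (Q.leaf j) ≤ Q.len j} := hjx
    rw [← orderedTour_image hn p j le_rfl] at hmem
    refine image_mono (Icc_subset_Icc ?_ ?_) hmem
    · rw [orderedVisit]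
      linarith [arcStart_nonneg j (Q := Q)]
    · have := arcStart_add_le_sum (Q := Q) (i := j)
        (t := Finset.univ.filter fun k => Q.len k ≤ α / 2) fun k hk => by
          simpa using (len_le_of_arcKey_le hk).trans hj
      rw [orderedVisit]
      linarith

lemma exists_isLocalSearch_shortArcs (hbal : Q.IsBalanced) (hn : 0 < n)
    {i₀ i : Fin n} (hmax : ∀ j, Q.arcKey j ≤ Q.arcKey i₀) {p : ℝ} (hp0 : 0 ≤ p)
    (hp : p ≤ 2 * Q.len i₀) (hi : Q.len i ≤ α / 2) (hi₀ : α / 2 < Q.len i₀) :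
    ∃ r, Q.IsLocalSearch α (Q.orderedTour hn p) (Q.closureComponent α i) p r ∧
      (Q.orderedTour hn p).toFun p = (Q.orderedTour hn p).toFun r := by
  set σ : ℝ := ∑ j with Q.len j ≤ α / 2, 2 * Q.len j with hσ
  have hlen : 2 * Q.length.real (Q.shortArcs α) = σ := by
    rw [length_shortArcs, Finset.mul_sum]
  have hσ0 : 0 ≤ σ := Finset.sum_nonneg fun j _ => by linarith [Q.len_pos j]
  have hshort : ∀ j, Q.len j ≤ α / 2 → Q.arcStart j + 2 * Q.len j ≤ σ := fun j hj =>
    arcStart_add_le_sum fun k hk => by simpa using (len_le_of_arcKey_le hk).trans hj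
  have hlarge : ∀ j, α / 2 < Q.len j → σ ≤ Q.arcStart j := fun j hj => by
    refine sum_two_len_le fun k hk => ?_
    simp only [Finset.mem_filter, Finset.mem_univ, true_and] at hk ⊢
    exact arcKey_lt_of_len_lt (hk.trans_lt hj)
  have hmaxeq := arcStart_of_isMax hmax
  have hμ := Q.totalLength_pos hn
  have hσμ : p + σ ≤ 2 * Q.totalLength := by linarith [hlarge i₀ hi₀]
  have hc0 : (Q.orderedTour hn p).toFun p = Q.arc ⟨0, hn⟩ 0 := by
    have := orderedTour_eq_center hn (p := p) le_rfl (by linarith : 0 ≤ 2 * Q.totalLength)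
      fun j => Or.inr (arcStart_nonneg j)
    rwa [add_zero] at this
  have hc1 : (Q.orderedTour hn p).toFun (p + σ) = Q.arc ⟨0, hn⟩ 0 :=
    orderedTour_eq_center hn hσ0 (by linarith) fun j =>
      (le_or_gt (Q.len j) (α / 2)).imp (hshort j) (hlarge j)
  have himg := orderedTour_image_shortArcs hn p hi
  rw [closureComponent_of_le hi]
  simp only [IsLocalSearch, hlen]
  rcases le_or_gt (α / 2) (Q.length.real (Q.shortArcs α)) with hle | hlt
  · exact ⟨p + σ, ⟨hp0, hσμ, hc0.trans hc1.symm, himg, fun _ => rfl,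
      fun h => absurd h (not_lt.2 hle)⟩, hc0.trans hc1.symm⟩
  -- the arc searched after the short ones
  obtain ⟨k, hk, hkmin⟩ := Finset.exists_min_image
    (Finset.univ.filter fun j => α / 2 < Q.len j) Q.arcKey ⟨i₀, by simpa using hi₀⟩
  simp only [Finset.mem_filter, Finset.mem_univ, true_and] at hk hkmin
  have hkstart : Q.arcStart k = σ := by
    refine le_antisymm (sum_two_len_le fun j hj => ?_) (hlarge k hk)
    simp only [Finset.mem_filter, Finset.mem_univ, true_and] at hj ⊢
    by_contra h
    exact absurd (hkmin j (not_le.1 h)) (not_le.2 hj)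
  -- If the first long arc were already the last arc, then σ = 2μ - 2ℓ_k ≥ 2ℓ_k > α by balance,
  -- against σ < α. Hence the tour is back at the center before the period ends.
  have hki : k ≠ i₀ := by
    rintro rfl
    have := hbal k
    linarith
  have hkend := arcStart_add_le_arcStart (lt_of_le_of_ne (hmax k) (arcKey_injective.ne hki))
  have hkpos := Q.len_pos k
  have hc2 : (Q.orderedTour hn p).toFun (p + (σ + 2 * Q.len k)) = Q.arc ⟨0, hn⟩ 0 := by
    refine orderedTour_eq_center hn (by linarith) (by linarith [Q.len_pos i₀]) fun j => ?_
    rw [← hkstart]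
    rcases lt_trichotomy (Q.arcKey j) (Q.arcKey k) with h | h | h
    · left
      linarith [arcStart_add_le_arcStart h]
    · rw [arcKey_injective h]
      exact Or.inl le_rfl
    · exact Or.inr (arcStart_add_le_arcStart h)
  refine ⟨p + (σ + 2 * Q.len k), ⟨hp0, hσμ, hc0.trans hc1.symm, himg,
    fun h => absurd h (not_le.2 hlt), fun _ => ⟨by linarith, ?_, ?_, ?_⟩⟩, hc0.trans hc2.symm⟩
  · show p + (σ + 2 * Q.len k) ≤ 2 * Q.totalLength
    linarith
  · rw [hc2]
    exact ⟨i, hi, by rw [dist_center_leaf]⟩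
  · rintro t ⟨ht1, ht2⟩ ⟨j, hj, hjt⟩
    have habs : |t - Q.orderedVisit p k| < Q.len k := by
      rw [orderedVisit, hkstart, abs_lt]
      constructor <;> linarith
    have h1 := dist_orderedTour_leaf hn p k habs.le
    have hjk : j ≠ k := fun h => by subst h; linarith
    have := Q.len_add_len_le_dist_leaf hjk ((Q.orderedTour hn p).toFun t)
    linarith

/-- `E`-patrolling strategies exist. -/
theorem LeafCondition.exists_isEPatrolTour (hQ : Q.LeafCondition α) (hα : 0 < α) (hn : 0 < n)
    (h : Q.IsBalanced ∨ ∀ i, 2 * Q.len i ≤ α) : ∃ P : Q.ClosedPath, Q.IsEPatrolTour α P := by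
  have hCPT : ∀ p, (Q.orderedTour hn p).IsCPT := fun p =>
    (ClosedPath.isCPT_iff hn).2 ⟨(isSeparated_orderedVisit p).isTour_tour hn, rfl⟩
  by_cases hcl : closure (Q.extremitySet α) = univ
  · exact ⟨Q.orderedTour hn 0, Or.inl ⟨hcl, hCPT 0⟩⟩
  obtain ⟨l, hl⟩ := hQ.exists_long_arc hα hcl
  have hbal : Q.IsBalanced := h.resolve_right fun h => by linarith [h l]
  obtain ⟨i₀, -, hmax⟩ := Finset.exists_max_image Finset.univ Q.arcKey ⟨l, Finset.mem_univ l⟩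
  replace hmax : ∀ j, Q.arcKey j ≤ Q.arcKey i₀ := fun j => hmax j (Finset.mem_univ j)
  have hi₀ : α / 2 < Q.len i₀ := hl.trans_le (len_le_of_arcKey_le (hmax l))
  -- Time 0 falls on the way back along the longest arc, at distance p from the center; this p is
  -- the midpoint of the part of that arc outside the closure of E.
  set p : ℝ := (Q.len i₀ - α / 2) / 2 with hp
  have hp0 : 0 < p := by linarith
  have hp1 : p < Q.len i₀ - α / 2 := by linarith
  have hstart : (Q.orderedTour hn p).toFun 0 = Q.arc i₀ p := by
    have h1 : (2 * Q.totalLength) - Q.orderedVisit p i₀ = Q.len i₀ - p := by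
      rw [orderedVisit, ← arcStart_of_isMax hmax]
      ring
    have h2 : |(2 * Q.totalLength) - Q.orderedVisit p i₀| = Q.len i₀ - p := by
      rw [h1, abs_of_nonneg (by linarith)]
    have h3 := orderedTour_apply hn p i₀ (t := 2 * Q.totalLength) (by linarith)
    rw [h2, sub_sub_cancel] at h3
    rw [← h3]
    exact (Q.orderedTour hn p).periodic.eq.symm
  refine hQ.exists_isEPatrolTour_of_localSearch hα hbal hcl hn (hCPT p) ?_ ?_ fun K hK => ?_
  · exact ⟨i₀, p, hp0, by linarith, hstart⟩
  · rw [hstart, hQ.mem_closure_extremitySet_iff hα]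
    rintro ⟨j, hj⟩
    by_cases hij : i₀ = j
    · subst hij
      rw [dist_arc_leaf_same Q hp0.le (by linarith)] at hj
      linarith [Q.extremityLength_le_half (α := α) i₀]
    · rw [dist_arc_leaf_ne Q hij hp0.le (by linarith)] at hj
      linarith [Q.extremityLength_le_len (α := α) j]
  · obtain ⟨i, rfl⟩ : K ∈ range (Q.closureComponent α) := hQ.closureComponents_eq hα ▸ hK
    rcases lt_or_ge (α / 2) (Q.len i) with hi | hi
    · exact ⟨_, _, isLocalSearch_leaf hα hn hmax hp0.le hp1.le hi⟩
    · exact ⟨p, exists_isLocalSearch_shortArcs hbal hn hmax hp0.le (by linarith) hi hi₀⟩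

end StarNetwork

end

/-! ### Both bounds combined -/

theorem mainTheorem4 (n : ℕ) (hn : 2 ≤ n) (Q : StarNetwork n) (α : ℝ) (hα : 0 < α)
    (hα' : α < 2 * Q.totalLength)
    (h : Q.IsBalanced ∨ ∀ i, 2 * Q.len i ≤ α) :
    Q.LeafCondition α ∧
    Q.IsOptimalAttack α (Q.eAttack α) ∧
    (∃ P : Q.ClosedPath, Q.IsEPatrolTour α P) ∧
    (∀ P : Q.ClosedPath, Q.IsEPatrolTour α P → Q.IsOptimalPatrol α P.randomized) ∧
    Q.HasValue α (α / (Q.totalLength + Q.length.real (Q.extremitySet α))) := by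
  have hn' : 0 < n := by omega
  have hQ := Q.leafCondition h
  have hprob := hQ.isProbabilityMeasure_eAttack hα hn'
  have hex := hQ.exists_isEPatrolTour hα hn' h
  obtain ⟨hA1, hA2⟩ := StarNetwork.upperValue_le hα (hQ.eAttack_intercepts_le hα hn')
  have hP := fun (P : Q.ClosedPath) (hP : Q.IsEPatrolTour α P) =>
    StarNetwork.le_lowerValue hα (hP.le_randomized hQ hα hn' hα' h)
  have hlu := StarNetwork.lowerValue_le_upperValue (Q := Q) (α := α)
  obtain ⟨P₀, hP₀⟩ := hex
  -- V ≤ guarantee of `P₀` ≤ lower value ≤ upper value ≤ guarantee of the E-attack ≤ V, so all of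
  -- these are equal.
  have hlow := (hP P₀ hP₀).1.trans (hP P₀ hP₀).2
  have hup := hA1.trans hA2
  have hl := le_antisymm (hlu.trans hup) hlow
  have hu := le_antisymm hup (hlow.trans hlu)
  refine ⟨hQ, ⟨hprob, le_antisymm (hu ▸ hA2) hA1⟩, ⟨P₀, hP₀⟩, fun P hPE =>
    ⟨inferInstance, le_antisymm (hP P hPE).2 (hl ▸ (hP P hPE).1)⟩, hl, hu⟩
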